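/- Let $n\ge 1$, $d=2^n$, let $H$ be a Hermitian operator on $n$ qubits, $\Delta t\in\mathbb{R}$, and let $U$ be a unitary on $n$ qubits (an approximation of the short-time evolution $e^{-iH\Delta t}$) with error $\epsilon=\lVert U-e^{-iH\Delta t}\rVert_2$ in the Schatten 2-norm. Let $V(\alpha)$, $\alpha\in\Theta$, be a unitary quantum neural network of fixed architecture: a product of $K$ parameterized unitary gates, each acting on at most $\kappa$ qubits, and of arbitrarily many fixed unitaries on all $n$ qubits. Let $N\ge 1$, $M\ge 0$ be integers and $0<\delta<1$; if $K=1$, assume $\delta\le 1/2$. Let $|\psi_i^{(j)}\rangle$, $1\le i\le n$, $1\le j\le N$, be independent Haar-random single-qubit states, and let the training data be the pairs $(|\Psi^{(j)}\rangle,|\Phi^{(j)}\rangle)$ with $|\Psi^{(j)}\rangle=\bigotimes_{i=1}^n|\psi_i^{(j)}\rangle$ and $|\Phi^{(j)}\rangle=U|\Psi^{(j)}\rangle$. The local training cost is $$C^{L}(\alpha)=\frac1N\sum_{j=1}^N \mathrm{Tr}\Big[V(\alpha)^\dagger|\Phi^{(j)}\rangle\langle\Phi^{(j)}|V(\alpha)\Big(\mathbb{1}-\frac1n\sum_{i=1}^n|\psi_i^{(j)}\rangle\langle\psi_i^{(j)}|\otimes\mathbb{1}_{\bar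 i}\Big)\Big],$$ where $\mathbb{1}_{\bar i}$ is the identity on all qubits but the $i$-th. Let $\alpha_{\rm opt}$ be the parameter setting after training, an arbitrary (possibly randomized) function of the training data. The $M$-step simulation fidelity is $$\overline F(\alpha,M\Delta t)=\mathbb{E}_{|\Psi\rangle\sim\mathrm{Haar}_n}\big[\,|\langle\Psi|(e^{-iHM\Delta t})^\dagger V(\alpha)^M|\Psi\rangle|^2\,\big].$$ Then there is a constant $C>0$ depending only on the locality $\kappa$ of the gates such that, with probability at least $1-\delta$, $$\overline F(\alpha_{\rm opt},M\Delta t)\ \ge\ 1-2M^2\Big[\frac{\epsilon^2}{d+1}+4n\,C^{L}(\alpha_{\rm opt})\Big]-C\,M^2 n\Big(\sqrt{\frac{K\log K}{N}}+\sqrt{\frac{\log(1/\delta)}{N}}\Big)$$ (with $K\log K=0$ for $K=0$). -/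

import Mathlib

open MeasureTheory ProbabilityTheory Matrix

namespace QSim

noncomputable section

/-- Labels of the computational basis of `n` qubits; there are `2 ^ n` of them. -/
abbrev Bits (n : ℕ) : Type := Fin n → Fin 2

/-- Operators on `n` qubits, written in the computational basis. -/
abbrev Op (n : ℕ) : Type := Matrix (Bits n) (Bits n) ℂ

/-- Pure states: unit vectors of the Hilbert space with orthonormal basis `ι`. -/
abbrev PureState (ι : Type) [Fintype ι] : Type := Metric.sphere (0 : EuclideanSpace ℂ ι) 1

/-- The coordinates of a pure state. -/
def PureState.vec {ι : Type} [Fintype ι] (ψ : PureState ι) : ι → ℂ :=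
  WithLp.ofLp (ψ : EuclideanSpace ℂ ι)

/-- The Haar measure on pure states: the surface measure of the unit sphere of `ℂ^ι`,
normalized to total mass one. -/
def haarState (ι : Type) [Fintype ι] : Measure (PureState ι) :=
  ((volume : Measure (EuclideanSpace ℂ ι)).toSphere Set.univ)⁻¹ •
    (volume : Measure (EuclideanSpace ℂ ι)).toSphere

/-- The rank-one operator `|v⟩⟨v|`. -/
def ketbra {ι : Type} (v : ι → ℂ) : Matrix ι ι ℂ := vecMulVec v (star v)

/-- The operator `G ⊗ 1` where `G` acts on the qubits in `S` and the identity on the others. -/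
def onQubits {n : ℕ} (S : Finset (Fin n)) (G : Matrix (S → Fin 2) (S → Fin 2) ℂ) : Op n :=
  Matrix.of fun x y =>
    if ∀ j, j ∉ S → x j = y j then G (fun i => x i) (fun i => y i) else 0

/-- The operator `A ⊗ 1` where `A` acts on qubit `i` and the identity on the others. -/
def onQubit {n : ℕ} (i : Fin n) (A : Matrix (Fin 2) (Fin 2) ℂ) : Op n :=
  Matrix.of fun x y => if ∀ j, j ≠ i → x j = y j then A (x i) (y i) else 0

/-- An element of a parameterized circuit on `n` qubits with parameters in `Θ`: a fixed
(non-trainable) unitary on all qubits, or a parameterized unitary gate on the qubits in `S`. -/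
inductive Gate (n : ℕ) (Θ : Type*)
  | fixed (W : Matrix.unitaryGroup (Bits n) ℂ)
  | trainable (S : Finset (Fin n)) (g : Θ → Matrix.unitaryGroup (S → Fin 2) ℂ)

namespace Gate

variable {n : ℕ} {Θ : Type*}

/-- The operator that a circuit element implements at the parameter `θ`. -/
def op (θ : Θ) : Gate n Θ → Op n
  | fixed W => W
  | trainable S g => onQubits S (g θ)

/-- Whether the circuit element is a parameterized gate. -/
def isTrainable : Gate n Θ → Bool
  | fixed _ => false
  | trainable _ _ => true

/-- A parameterized gate is `κ`-local if it acts on at most `κ` qubits; no restriction is put on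
the fixed unitaries. -/
def IsLocal (κ : ℕ) : Gate n Θ → Prop
  | fixed _ => True
  | trainable S _ => S.card ≤ κ

end Gate

/-- A unitary quantum neural network of fixed architecture: a sequence of fixed unitaries and
parameterized gates. Different gates may share components of the parameter. -/
abbrev QNN (n : ℕ) (Θ : Type*) : Type _ := List (Gate n Θ)

namespace QNN

variable {n : ℕ} {Θ : Type*}

/-- The operator `V(θ)` of the network. -/
def op (V : QNN n Θ) (θ : Θ) : Op n := (V.map (Gate.op θ)).prod

/-- The number of parameterized gates. -/
def numTrainable (V : QNN n Θ) : ℕ := V.countP Gate.isTrainable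

/-- All parameterized gates are `κ`-local. -/
def IsLocal (κ : ℕ) (V : QNN n Θ) : Prop := ∀ g ∈ V, Gate.IsLocal κ g

end QNN

/-- The coordinates of the product state `ψ_1 ⊗ ... ⊗ ψ_n`. -/
def productVec {n : ℕ} (ψ : Fin n → PureState (Fin 2)) : Bits n → ℂ :=
  fun x => ∏ i, (ψ i).vec (x i)

/-- The local loss observable `1 - (1/n) ∑ i, |ψ_i⟩⟨ψ_i| ⊗ 1`. -/
def localObservable {n : ℕ} (ψ : Fin n → PureState (Fin 2)) : Op n :=
  1 - (1 / (n : ℂ)) • ∑ i, onQubit i (ketbra (ψ i).vec)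

/-- The local loss `Tr[V† |Φ⟩⟨Φ| V O]` of `V` on the training pair `(Ψ, Φ)`, where
`Ψ = ψ_1 ⊗ ... ⊗ ψ_n`, `Φ = U Ψ`, and `O` is the local loss observable. -/
def localLoss {n : ℕ} (U V : Op n) (ψ : Fin n → PureState (Fin 2)) : ℝ :=
  (trace (Vᴴ * ketbra (U *ᵥ productVec ψ) * V * localObservable ψ)).re

/-- The local training cost on the `N` training inputs `ψ 0, ..., ψ (N-1)`. -/
def localTrainingCost {n N : ℕ} (U V : Op n) (ψ : Fin N → Fin n → PureState (Fin 2)) : ℝ :=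
  (1 / (N : ℝ)) * ∑ j, localLoss U V (ψ j)

/-- The average fidelity `E |⟨Ψ| U† V |Ψ⟩|²` over Haar-random states `Ψ`. -/
def avgFidelity {n : ℕ} (U V : Op n) : ℝ :=
  ∫ Ψ, ‖star (PureState.vec Ψ) ⬝ᵥ ((Uᴴ * V) *ᵥ PureState.vec Ψ)‖ ^ 2 ∂(haarState (Bits n))

/-- The time evolution `exp(-i t H)`. -/
def evolution {n : ℕ} (H : Op n) (t : ℝ) : Op n :=
  NormedSpace.exp ((-Complex.I * (t : ℂ)) • H)

/-- The Schatten 2-norm `√(Tr[A† A])`. -/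
def schattenTwoNorm {n : ℕ} (A : Op n) : ℝ := Real.sqrt (trace (Aᴴ * A)).re

/-- The fidelity of the simulation of `exp(-i M Δt H)` by `M` applications of the short-time
operator `V`. -/
def simFidelity {n : ℕ} (H : Op n) (Δt : ℝ) (M : ℕ) (V : Op n) : ℝ :=
  avgFidelity (evolution H ((M : ℝ) * Δt)) (V ^ M)

end

end QSim

namespace QSim

/-- The action of a linear isometry on the unit sphere. -/
noncomputable def sphereEquiv {E : Type*} [NormedAddCommGroup E] [NormedSpace ℝ E]
    [MeasurableSpace E] [BorelSpace E] (e : E ≃ₗᵢ[ℝ] E) :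
    Metric.sphere (0 : E) 1 ≃ᵐ Metric.sphere (0 : E) 1 where
  toFun x := ⟨e x, by simp⟩
  invFun x := ⟨e.symm x, by simp⟩
  left_inv x := by simp
  right_inv x := by simp
  measurable_toFun :=
    (e.continuous.comp continuous_subtype_val).measurable.subtype_mk
  measurable_invFun :=
    (e.symm.continuous.comp continuous_subtype_val).measurable.subtype_mk

open scoped Pointwise in
theorem measurePreserving_sphereEquiv {E : Type*} [NormedAddCommGroup E]
    [NormedSpace ℝ E] [MeasurableSpace E] [BorelSpace E] (μ : Measure E) (e : E ≃ₗᵢ[ℝ] E)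
    (he : MeasurePreserving e μ μ) :
    MeasurePreserving (sphereEquiv e) μ.toSphere μ.toSphere := by
  refine ⟨(sphereEquiv e).measurable, ?_⟩
  ext s hs
  rw [Measure.map_apply (sphereEquiv e).measurable hs, Measure.toSphere_apply' _ hs,
    Measure.toSphere_apply' _ ((sphereEquiv e).measurable hs)]
  congr 1
  rw [← he.measure_preimage_emb e.toHomeomorph.measurableEmbedding 
    (Set.Ioo (0 : ℝ) 1 • (Subtype.val '' s))]
  congr 1
  ext x
  simp only [Set.mem_smul, Set.mem_image, Set.mem_preimage]
  constructor
  · rintro ⟨r, hr, _, ⟨y, hy, rfl⟩, rfl⟩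
    exact ⟨r, hr, _, ⟨_, hy, rfl⟩, by simp [sphereEquiv]⟩
  · rintro ⟨r, hr, _, ⟨y, hy, rfl⟩, h⟩
    refine ⟨r, hr, _, ⟨(sphereEquiv e).symm y, by simpa using hy, rfl⟩, ?_⟩
    apply e.injective
    rw [← h]
    simp [sphereEquiv]

variable {ι : Type} [Fintype ι]

instance [Nonempty ι] : IsProbabilityMeasure (haarState ι) := by
  refine ⟨?_⟩
  unfold haarState
  rw [Measure.smul_apply, smul_eq_mul]
  refine ENNReal.inv_mul_cancel ?_ (measure_ne_top _ _)
  rw [Measure.measure_univ_ne_zero]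
  exact Measure.toSphere_ne_zero _

theorem measurePreserving_haarState (e : EuclideanSpace ℂ ι ≃ₗᵢ[ℝ] EuclideanSpace ℂ ι) :
    MeasurePreserving (sphereEquiv e) (haarState ι) (haarState ι) :=
  (measurePreserving_sphereEquiv _ e e.measurePreserving).smul_measure _

theorem integral_haarState_unitary [DecidableEq ι] {W : Matrix ι ι ℂ}
    (hW : W ∈ unitaryGroup ι ℂ) (f : (ι → ℂ) → ℝ) :
    ∫ ψ, f (W *ᵥ PureState.vec ψ) ∂(haarState ι) = ∫ ψ, f (PureState.vec ψ) ∂(haarState ι) := by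
  let u : unitary (EuclideanSpace ℂ ι →L[ℂ] EuclideanSpace ℂ ι) :=
    ⟨toEuclideanCLM (n := ι) (𝕜 := ℂ) W, Unitary.map_mem (toEuclideanCLM (n := ι) (𝕜 := ℂ)) hW⟩
  let e₀ : EuclideanSpace ℂ ι ≃ₗᵢ[ℂ] EuclideanSpace ℂ ι := Unitary.linearIsometryEquiv u
  let e : EuclideanSpace ℂ ι ≃ₗᵢ[ℝ] EuclideanSpace ℂ ι :=
    { e₀.toLinearEquiv.restrictScalars ℝ with norm_map' := e₀.norm_map }
  have h := (measurePreserving_haarState e).integral_comp' (g := fun ψ => f (PureState.vec ψ))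
  rw [← h]
  rfl

theorem sum_normSq_vec (ψ : PureState ι) : ∑ i, ‖ψ.vec i‖ ^ 2 = 1 := by
  have h : ‖(ψ : EuclideanSpace ℂ ι)‖ = 1 := by simp
  have := EuclideanSpace.norm_sq_eq (ψ : EuclideanSpace ℂ ι)
  rw [h] at this
  simpa [PureState.vec] using this.symm

@[fun_prop]
theorem continuous_vec : Continuous (PureState.vec : PureState ι → ι → ℂ) := by
  unfold PureState.vec
  fun_prop

theorem integrable_haarState [Nonempty ι] {f : PureState ι → ℝ} (hf : Continuous f) :
    Integrable f (haarState ι) :=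
  hf.integrable_of_hasCompactSupport (HasCompactSupport.of_compactSpace f)

theorem diagonal_mem_unitaryGroup [DecidableEq ι] {v : ι → ℂ} (hv : ∀ i, ‖v i‖ = 1) :
    diagonal v ∈ unitaryGroup ι ℂ := by
  rw [mem_unitaryGroup_iff, star_eq_conjTranspose, diagonal_conjTranspose, diagonal_mul_diagonal,
    ← diagonal_one]
  congr 1
  ext i
  simp [Complex.mul_conj, Complex.normSq_eq_norm_sq, hv]

/-- The complex reflection with eigenvalue `w` on `e_i + e_j`. -/
noncomputable def planeRotation [DecidableEq ι] (i j : ι) (w : ℂ) : Matrix ι ι ℂ :=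
  1 - ((1 - w) / 2) • vecMulVec (Pi.single i 1 + Pi.single j 1) (Pi.single i 1 + Pi.single j 1)

theorem planeRotation_mulVec [DecidableEq ι] (i j : ι) (w : ℂ) (x : ι → ℂ) :
    planeRotation i j w *ᵥ x =
      x - ((1 - w) / 2 * (x i + x j)) • (Pi.single i 1 + Pi.single j 1) := by
  rw [planeRotation, sub_mulVec, one_mulVec, smul_mulVec, vecMulVec_mulVec]
  ext k
  simp [add_dotProduct]
  ring

theorem planeRotation_mem_unitaryGroup [DecidableEq ι] {i j : ι} (hij : i ≠ j) {w : ℂ}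
    (hw : ‖w‖ = 1) : planeRotation i j w ∈ unitaryGroup ι ℂ := by
  set v : ι → ℂ := Pi.single i 1 + Pi.single j 1 with hv
  have hvv : v ⬝ᵥ v = 2 := by
    simp [hv, hij, hij.symm]; norm_num
  have hstar : star v = v := by
    ext k; simp [hv, Pi.single_apply]
  have hww : w * star w = 1 := by
    simp [Complex.mul_conj, Complex.normSq_eq_norm_sq, hw]
  have hP : vecMulVec v v * vecMulVec v v = (2 : ℂ) • vecMulVec v v := by
    rw [vecMulVec_mul_vecMulVec, hvv]
    ext a b; simp [vecMulVec_apply]; ring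
  rw [mem_unitaryGroup_iff, star_eq_conjTranspose, planeRotation, conjTranspose_sub,
    conjTranspose_one, conjTranspose_smul, ← hv, conjTranspose_vecMulVec, hstar, sub_mul, mul_sub,
    mul_sub, smul_mul_smul_comm, hP, smul_smul, one_mul, one_mul, mul_one]
  have : star ((1 - w) / 2) = (1 - star w) / 2 := by simp
  rw [this, sub_sub, sub_eq_self, ← add_sub_assoc, ← add_smul, ← sub_smul]
  convert zero_smul ℂ _
  linear_combination (1 / 2 : ℂ) * (- hww)

/-- The moments `E |ψ_i|² |ψ_j|²` of a Haar-random state. -/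
noncomputable def haarMoment (i j : ι) : ℝ :=
  ∫ ψ, ‖PureState.vec ψ i‖ ^ 2 * ‖PureState.vec ψ j‖ ^ 2 ∂(haarState ι)

theorem haarMoment_self_eq (i j : ι) : haarMoment i i = haarMoment j j := by
  classical
  by_cases hij : i = j
  · rw [hij]
  have h := integral_haarState_unitary (planeRotation_mem_unitaryGroup hij (w := -1) (by simp))
    (fun x => ‖x i‖ ^ 2 * ‖x i‖ ^ 2)
  rw [haarMoment, haarMoment, ← h]
  refine integral_congr_ae (.of_forall fun ψ => ?_)
  simp only [planeRotation_mulVec]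
  simp [hij]

theorem haarMoment_of_ne [Nonempty ι] {i j : ι} (hij : i ≠ j) :
    haarMoment i j = (haarMoment i i + haarMoment j j) / 4 := by
  classical
  have h := integral_haarState_unitary
    (planeRotation_mem_unitaryGroup hij (w := Complex.I) (by simp))
    (fun x => ‖x i‖ ^ 2 * ‖x j‖ ^ 2)
  have key : ∀ x y : ℂ, ‖x - (1 - Complex.I) / 2 * (x + y)‖ ^ 2 *
      ‖y - (1 - Complex.I) / 2 * (x + y)‖ ^ 2 = ‖x ^ 2 + y ^ 2‖ ^ 2 / 4 := fun x y => by
    have hI : Complex.I ^ 2 = -1 := Complex.I_sq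
    have : (x - (1 - Complex.I) / 2 * (x + y)) * (y - (1 - Complex.I) / 2 * (x + y)) =
      (-1 / 2) * (x ^ 2 + y ^ 2) := by
      linear_combination (1 / 4 : ℂ) * (x + y) ^ 2 * hI
    rw [← mul_pow, ← norm_mul, this, norm_mul, mul_pow]
    norm_num
    ring
  have hflip := integral_haarState_unitary
    (diagonal_mem_unitaryGroup (v := fun k => if k = j then Complex.I else 1)
      (fun k => by split_ifs <;> simp)) (fun x => ‖x i ^ 2 + x j ^ 2‖ ^ 2)
  have hpar : ∀ x y : ℂ, ‖x ^ 2 + y ^ 2‖ ^ 2 + ‖x ^ 2 - y ^ 2‖ ^ 2 =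
      2 * (‖x‖ ^ 2 * ‖x‖ ^ 2 + ‖y‖ ^ 2 * ‖y‖ ^ 2) := fun x y => by
    have := parallelogram_law_with_norm ℝ (x ^ 2) (y ^ 2)
    simp only [norm_pow] at this
    nlinarith [this]
  simp only [mulVec_diagonal, hij, if_true, if_false, one_mul, mul_pow, Complex.I_sq,
    neg_mul, ← sub_eq_add_neg] at hflip
  have hsum : (∫ ψ : PureState ι, ‖ψ.vec i ^ 2 + ψ.vec j ^ 2‖ ^ 2 ∂haarState ι) +
      ∫ ψ : PureState ι, ‖ψ.vec i ^ 2 - ψ.vec j ^ 2‖ ^ 2 ∂haarState ι =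
      2 * (haarMoment i i + haarMoment j j) := by
    rw [← integral_add (integrable_haarState (by fun_prop)) (integrable_haarState (by fun_prop)),
      haarMoment, haarMoment, ← integral_add (integrable_haarState (by fun_prop))
        (integrable_haarState (by fun_prop)), ← integral_const_mul]
    exact integral_congr_ae (.of_forall fun ψ => hpar _ _)
  have hrot : haarMoment i j =
      (∫ ψ : PureState ι, ‖ψ.vec i ^ 2 + ψ.vec j ^ 2‖ ^ 2 ∂haarState ι) / 4 := by
    rw [haarMoment, ← h, ← integral_div]
    refine integral_congr_ae (.of_forall fun ψ => ?_)
    simp only [planeRotation_mulVec]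
    simp [hij, hij.symm, key]
  linarith

theorem sum_haarMoment [Nonempty ι] : ∑ i : ι, ∑ j : ι, haarMoment i j = 1 := by
  simp only [haarMoment]
  have hinteg : ∀ i j : ι, Integrable
      (fun ψ : PureState ι => ‖ψ.vec i‖ ^ 2 * ‖ψ.vec j‖ ^ 2) (haarState ι) :=
    fun i j => integrable_haarState (by fun_prop)
  rw [Finset.sum_congr rfl fun i _ => (integral_finsetSum _ fun j _ => hinteg i j).symm,
    ← integral_finsetSum _ fun i _ => integrable_finsetSum _ fun j _ => hinteg i j]
  simp only [← Finset.mul_sum, sum_normSq_vec, mul_one]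
  simp

theorem haarMoment_eq [Nonempty ι] [DecidableEq ι] (i j : ι) :
    haarMoment i j =
      (if i = j then 2 else 1) / ((Fintype.card ι : ℝ) * (Fintype.card ι + 1)) := by
  obtain ⟨b, hb⟩ : ∃ b, ∀ i : ι, haarMoment i i = 2 * b :=
    ⟨haarMoment i i / 2, fun k => by rw [haarMoment_self_eq k i]; ring⟩
  have hall : ∀ i j : ι, haarMoment i j = if i = j then 2 * b else b := fun i j => by
    split_ifs with h
    · rw [← h, hb]
    · rw [haarMoment_of_ne h, hb, hb]; ring
  have hs := sum_haarMoment (ι := ι)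
  have hd : (0 : ℝ) < Fintype.card ι := by exact_mod_cast Fintype.card_pos
  have hrow : ∀ i : ι, ∑ j, haarMoment i j = b * (Fintype.card ι + 1) := fun i => by
    have : ∀ j, haarMoment i j = b + if i = j then b else 0 := fun j => by
      rw [hall]; split_ifs <;> ring
    simp only [this, Finset.sum_add_distrib]
    simp
    ring
  simp only [hrow] at hs
  simp only [Finset.sum_const, Finset.card_univ, nsmul_eq_mul] at hs
  rw [hall, eq_div_iff (by positivity)]
  split_ifs
  · linear_combination 2 * hs
  · linear_combination hs

theorem star_mulVec_dotProduct [DecidableEq ι] (U X : Matrix ι ι ℂ) (x : ι → ℂ) :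
    star (U *ᵥ x) ⬝ᵥ (X *ᵥ (U *ᵥ x)) = star x ⬝ᵥ ((Uᴴ * X * U) *ᵥ x) := by
  rw [star_mulVec, ← dotProduct_mulVec, mulVec_mulVec, mulVec_mulVec, Matrix.mul_assoc]

theorem haarState_secondMoment_hermitian [Nonempty ι] [DecidableEq ι] {X : Matrix ι ι ℂ}
    (hX : X.IsHermitian) :
    ∫ ψ : PureState ι, (star ψ.vec ⬝ᵥ (X *ᵥ ψ.vec)).re ^ 2 ∂(haarState ι) =
      ((trace X).re ^ 2 + (trace (X * X)).re) /
        ((Fintype.card ι : ℝ) * (Fintype.card ι + 1)) := by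
  set U : Matrix ι ι ℂ := (hX.eigenvectorUnitary : Matrix ι ι ℂ) with hU
  set l := hX.eigenvalues with hl
  have hUU : U ∈ unitaryGroup ι ℂ := hX.eigenvectorUnitary.2
  have h1 : Uᴴ * U = 1 := mem_unitaryGroup_iff'.1 hUU
  have h2 : U * Uᴴ = 1 := mem_unitaryGroup_iff.1 hUU
  set D : Matrix ι ι ℂ := diagonal (fun i => (l i : ℂ)) with hD
  have hspec : X = U * D * Uᴴ := by
    have := hX.spectral_theorem
    rw [Unitary.conjStarAlgAut_apply] at this
    exact this
  have hdiag : Uᴴ * X * U = D := by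
    rw [hspec, ← Matrix.mul_assoc, ← Matrix.mul_assoc, h1, Matrix.one_mul, Matrix.mul_assoc, h1,
      Matrix.mul_one]
  have htr : trace X = ∑ i, (l i : ℂ) := by
    rw [hspec, Matrix.mul_assoc, trace_mul_comm, Matrix.mul_assoc, h1, Matrix.mul_one,
      trace_diagonal]
  have htr2 : trace (X * X) = ∑ i, (l i : ℂ) * l i := by
    have : X * X = U * (D * D) * Uᴴ := by
      nth_rw 1 2 [hspec]
      simp only [Matrix.mul_assoc]
      rw [← Matrix.mul_assoc Uᴴ U, h1, Matrix.one_mul]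
    rw [this, Matrix.mul_assoc, trace_mul_comm, Matrix.mul_assoc, h1, Matrix.mul_one,
      diagonal_mul_diagonal, trace_diagonal]
  rw [← integral_haarState_unitary hUU (fun x => (star x ⬝ᵥ (X *ᵥ x)).re ^ 2)]
  simp only [star_mulVec_dotProduct, hdiag]
  have hq : ∀ ψ : PureState ι, (star ψ.vec ⬝ᵥ (D *ᵥ ψ.vec)).re ^ 2 =
      ∑ i, ∑ j, l i * l j * (‖ψ.vec i‖ ^ 2 * ‖ψ.vec j‖ ^ 2) := fun ψ => by
    have : (star ψ.vec ⬝ᵥ (D *ᵥ ψ.vec)).re = ∑ i, l i * ‖ψ.vec i‖ ^ 2 := by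
      simp only [dotProduct, hD, mulVec_diagonal, Complex.re_sum]
      refine Finset.sum_congr rfl fun i _ => ?_
      rw [← Complex.normSq_eq_norm_sq, Complex.normSq_apply]
      simp
      ring
    rw [this, sq, Finset.sum_mul_sum]
    exact Finset.sum_congr rfl fun i _ => Finset.sum_congr rfl fun j _ => by ring
  have hinteg : ∀ i j : ι, Integrable
      (fun ψ : PureState ι => l i * l j * (‖ψ.vec i‖ ^ 2 * ‖ψ.vec j‖ ^ 2)) (haarState ι) :=
    fun i j => integrable_haarState (by fun_prop)
  simp only [hq]
  rw [integral_finsetSum _ fun i _ => integrable_finsetSum _ fun j _ => hinteg i j,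
    Finset.sum_congr rfl fun i _ => integral_finsetSum _ fun j _ => hinteg i j]
  simp only [integral_const_mul]
  have hmom : ∀ i j : ι, ∫ ψ : PureState ι, ‖ψ.vec i‖ ^ 2 * ‖ψ.vec j‖ ^ 2 ∂(haarState ι) =
    (1 + if i = j then 1 else 0) / ((Fintype.card ι : ℝ) * (Fintype.card ι + 1)) := fun i j => by
    rw [← haarMoment, haarMoment_eq]
    split_ifs <;> norm_num
  simp only [hmom, htr, htr2, ← Complex.ofReal_mul, ← Complex.ofReal_sum, Complex.ofReal_re]
  simp only [mul_div_assoc', ← Finset.sum_div, mul_add, Finset.sum_add_distrib, mul_one,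
    mul_ite, mul_zero, Finset.sum_ite_eq, Finset.mem_univ, if_true, sq, Finset.sum_mul_sum]

theorem haarState_secondMoment_re [Nonempty ι] [DecidableEq ι] (A : Matrix ι ι ℂ) :
    ∫ ψ : PureState ι, (star ψ.vec ⬝ᵥ (A *ᵥ ψ.vec)).re ^ 2 ∂(haarState ι) =
      ((trace A).re ^ 2 + ((trace (A * A)).re + (trace (Aᴴ * A)).re) / 2) /
        ((Fintype.card ι : ℝ) * (Fintype.card ι + 1)) := by
  set X : Matrix ι ι ℂ := (1 / 2 : ℂ) • (A + Aᴴ) with hXdef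
  have hX : X.IsHermitian := by
    rw [IsHermitian, hXdef, conjTranspose_smul, conjTranspose_add, conjTranspose_conjTranspose,
      add_comm Aᴴ]
    simp
  have hform : ∀ x : ι → ℂ, (star x ⬝ᵥ (X *ᵥ x)).re = (star x ⬝ᵥ (A *ᵥ x)).re := fun x => by
    have hc : star x ⬝ᵥ (Aᴴ *ᵥ x) = star (star x ⬝ᵥ (A *ᵥ x)) := by
      rw [star_dotProduct, star_mulVec, ← dotProduct_mulVec, conjTranspose_conjTranspose]
    rw [hXdef, smul_mulVec, dotProduct_smul, add_mulVec, dotProduct_add, hc]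
    simp
    ring
  have htr : (trace X).re = (trace A).re := by
    rw [hXdef, trace_smul, trace_add, trace_conjTranspose]
    simp
    ring
  have htr2 : (trace (X * X)).re = ((trace (A * A)).re + (trace (Aᴴ * A)).re) / 2 := by
    have hc : trace (Aᴴ * Aᴴ) = star (trace (A * A)) := by
      rw [← trace_conjTranspose, conjTranspose_mul]
    rw [hXdef, smul_mul_smul_comm, trace_smul, add_mul, mul_add, mul_add, trace_add, trace_add,
      trace_add, hc, trace_mul_comm A Aᴴ]
    simp
    norm_num
    ring
  rw [← htr2, ← htr, ← haarState_secondMoment_hermitian hX]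
  simp only [hform]

theorem haarState_secondMoment [Nonempty ι] [DecidableEq ι] (A : Matrix ι ι ℂ) :
    ∫ ψ : PureState ι, ‖star ψ.vec ⬝ᵥ (A *ᵥ ψ.vec)‖ ^ 2 ∂(haarState ι) =
      (‖trace A‖ ^ 2 + (trace (Aᴴ * A)).re) /
        ((Fintype.card ι : ℝ) * (Fintype.card ι + 1)) := by
  have h1 := haarState_secondMoment_re A
  have h2 := haarState_secondMoment_re ((-Complex.I) • A)
  have hsplit : ∀ x : ι → ℂ, ‖star x ⬝ᵥ (A *ᵥ x)‖ ^ 2 = (star x ⬝ᵥ (A *ᵥ x)).re ^ 2 +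
      (star x ⬝ᵥ (((-Complex.I) • A) *ᵥ x)).re ^ 2 := fun x => by
    rw [smul_mulVec, dotProduct_smul, ← Complex.normSq_eq_norm_sq, Complex.normSq_apply]
    simp
    ring
  have hcont : ∀ B : Matrix ι ι ℂ, Continuous
      fun ψ : PureState ι => (star ψ.vec ⬝ᵥ (B *ᵥ ψ.vec)).re ^ 2 := fun B => by
    have : Continuous fun ψ : PureState ι => star ψ.vec := continuous_star.comp continuous_vec
    exact (Complex.continuous_re.comp
      (this.dotProduct (continuous_const.matrix_mulVec continuous_vec))).pow 2
  simp only [hsplit]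
  rw [integral_add (integrable_haarState (hcont _)) (integrable_haarState (hcont _)), h1, h2,
    conjTranspose_smul, smul_mul_smul_comm, smul_mul_smul_comm, trace_smul, trace_smul, trace_smul,
    ← add_div, ← Complex.normSq_eq_norm_sq, Complex.normSq_apply]
  congr 1
  simp
  ring

end QSim

namespace QSim

/-- The expectation value `⟨v|A|v⟩`. -/
def expVal {ι : Type} [Fintype ι] (A : Matrix ι ι ℂ) (v : ι → ℂ) : ℂ := star v ⬝ᵥ (A *ᵥ v)

theorem expVal_eq_sum {ι : Type} [Fintype ι] (A : Matrix ι ι ℂ) (v : ι → ℂ) :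
    expVal A v = ∑ x, ∑ y, star (v x) * A x y * v y := by
  simp only [expVal, dotProduct, mulVec, Finset.mul_sum, Pi.star_apply, mul_assoc]

theorem expVal_add {ι : Type} [Fintype ι] (A B : Matrix ι ι ℂ) (v : ι → ℂ) :
    expVal (A + B) v = expVal A v + expVal B v := by
  simp [expVal, add_mulVec, dotProduct_add]

theorem expVal_sub {ι : Type} [Fintype ι] (A B : Matrix ι ι ℂ) (v : ι → ℂ) :
    expVal (A - B) v = expVal A v - expVal B v := by
  simp [expVal, sub_mulVec, dotProduct_sub]

theorem continuous_expVal {ι : Type} [Fintype ι] (A : Matrix ι ι ℂ) : Continuous (expVal A) := by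
  unfold expVal
  exact (continuous_star.comp continuous_id).dotProduct
    (continuous_const.matrix_mulVec continuous_id)

/-- The squared Frobenius norm. -/
noncomputable def frobSq {ι : Type} [Fintype ι] (A : Matrix ι ι ℂ) : ℝ := ∑ x, ∑ y, ‖A x y‖ ^ 2

theorem trace_conjTranspose_mul_self {ι : Type} [Fintype ι] (A : Matrix ι ι ℂ) :
    trace (Aᴴ * A) = (frobSq A : ℂ) := by
  simp only [trace, diag_apply, mul_apply, conjTranspose_apply, frobSq]
  rw [Finset.sum_comm]
  push_cast
  refine Finset.sum_congr rfl fun x _ => Finset.sum_congr rfl fun y _ => ?_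
  rw [mul_comm]
  simp [Complex.mul_conj, Complex.normSq_eq_norm_sq]

theorem norm_trace_sq_le {ι : Type} [Fintype ι] (A : Matrix ι ι ℂ) :
    ‖trace A‖ ^ 2 ≤ Fintype.card ι * frobSq A := by
  calc ‖trace A‖ ^ 2 ≤ (∑ x, ‖A x x‖) ^ 2 := by
        gcongr
        exact norm_sum_le _ _
    _ ≤ Fintype.card ι * ∑ x, ‖A x x‖ ^ 2 := by
        simpa using sq_sum_le_card_mul_sum_sq (s := Finset.univ) (f := fun x => ‖A x x‖)
    _ ≤ _ := by
        unfold frobSq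
        gcongr with x
        exact Finset.single_le_sum (f := fun y => ‖A x y‖ ^ 2) (fun _ _ => by positivity)
          (Finset.mem_univ x)

theorem frobSq_parallelogram {ι : Type} [Fintype ι] (A B : Matrix ι ι ℂ) :
    frobSq (A + B) + frobSq (A - B) = 2 * (frobSq A + frobSq B) := by
  simp only [frobSq, ← Finset.sum_add_distrib, Finset.mul_sum]
  refine Finset.sum_congr rfl fun x _ => Finset.sum_congr rfl fun y _ => ?_
  have := parallelogram_law_with_norm ℝ (A x y) (B x y)
  simp only [Matrix.add_apply, Matrix.sub_apply]
  nlinarith [this]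

/-- The law of `n` independent Haar-random qubits. -/
noncomputable def haarProduct (n : ℕ) : Measure (Fin n → PureState (Fin 2)) :=
  Measure.pi fun _ => haarState (Fin 2)

instance (n : ℕ) : IsProbabilityMeasure (haarProduct n) := by
  unfold haarProduct; infer_instance

theorem integrable_haarProduct {n : ℕ} {f : (Fin n → PureState (Fin 2)) → ℝ}
    (hf : Continuous f) : Integrable f (haarProduct n) :=
  hf.integrable_of_hasCompactSupport (HasCompactSupport.of_compactSpace f)

@[fun_prop]
theorem continuous_productVec {n : ℕ} :
    Continuous (productVec : (Fin n → PureState (Fin 2)) → Bits n → ℂ) := by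
  unfold productVec
  fun_prop

theorem continuous_expVal_productVec {n : ℕ} (A : Op n) :
    Continuous fun ψ : Fin n → PureState (Fin 2) => expVal A (productVec ψ) :=
  (continuous_expVal A).comp continuous_productVec

theorem sum_bits_succ {n : ℕ} {M : Type*} [AddCommMonoid M] (f : Bits (n + 1) → M) :
    ∑ x, f x = ∑ a : Fin 2, ∑ y : Bits n, f (Fin.cons a y) := by
  rw [← Fintype.sum_prod_type']
  exact (Fintype.sum_equiv (Fin.consEquiv fun _ : Fin (n + 1) => Fin 2) _ _ fun _ => rfl).symm

/-- The block of an operator selected by the values of the first qubit. -/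
def block {n : ℕ} (A : Op (n + 1)) (a b : Fin 2) : Op n :=
  Matrix.of fun x y => A (Fin.cons a x) (Fin.cons b y)

theorem frobSq_eq_sum_block {n : ℕ} (A : Op (n + 1)) :
    frobSq A = ∑ a, ∑ b, frobSq (block A a b) := by
  simp only [frobSq, sum_bits_succ, block, of_apply]
  exact Finset.sum_congr rfl fun a _ => Finset.sum_comm

theorem trace_eq_sum_block {n : ℕ} (A : Op (n + 1)) :
    trace A = ∑ a, trace (block A a a) := by
  simp only [trace, sum_bits_succ, block, of_apply, diag_apply]

theorem expVal_productVec_succ {n : ℕ} (A : Op (n + 1)) (ψ : Fin (n + 1) → PureState (Fin 2)) :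
    expVal A (productVec ψ) =
      expVal (Matrix.of fun a b => expVal (block A a b) (productVec fun i => ψ i.succ))
        (ψ 0).vec := by
  have hv : ∀ (a : Fin 2) (y : Bits n), productVec ψ (Fin.cons a y : Bits (n + 1)) =
      (ψ 0).vec a * productVec (fun i => ψ i.succ) y := fun a y => by
    simp [productVec, Fin.prod_univ_succ]
  simp only [expVal_eq_sum, sum_bits_succ, hv, of_apply, block]
  refine Finset.sum_congr rfl fun a _ => ?_
  rw [Finset.sum_comm]
  refine Finset.sum_congr rfl fun b _ => ?_
  simp only [Finset.mul_sum, Finset.sum_mul, star_mul']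
  exact Finset.sum_congr rfl fun x _ => Finset.sum_congr rfl fun y _ => by ring

theorem haarState_secondMoment_qubit (X : Matrix (Fin 2) (Fin 2) ℂ) :
    ∫ ψ : PureState (Fin 2), ‖expVal X ψ.vec‖ ^ 2 ∂(haarState (Fin 2)) =
      ‖X 0 0 + X 1 1‖ ^ 2 / 4 + ‖X 0 0 - X 1 1‖ ^ 2 / 12 +
        (‖X 0 1‖ ^ 2 + ‖X 1 0‖ ^ 2) / 6 := by
  have h := haarState_secondMoment X
  rw [trace_conjTranspose_mul_self, Complex.ofReal_re] at h
  unfold expVal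
  rw [h]
  have := parallelogram_law_with_norm ℝ (X 0 0) (X 1 1)
  simp only [frobSq, Fin.sum_univ_two, trace_fin_two, Fintype.card_fin]
  push_cast
  linarith

theorem integral_haarProduct_succ {n : ℕ} (A : Op (n + 1)) :
    ∫ ψ, ‖expVal A (productVec ψ)‖ ^ 2 ∂(haarProduct (n + 1)) =
      (∫ ψ, ‖expVal (block A 0 0 + block A 1 1) (productVec ψ)‖ ^ 2 ∂(haarProduct n)) / 4 +
      (∫ ψ, ‖expVal (block A 0 0 - block A 1 1) (productVec ψ)‖ ^ 2 ∂(haarProduct n)) / 12 +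
      ((∫ ψ, ‖expVal (block A 0 1) (productVec ψ)‖ ^ 2 ∂(haarProduct n)) +
        ∫ ψ, ‖expVal (block A 1 0) (productVec ψ)‖ ^ 2 ∂(haarProduct n)) / 6 := by
  let g : PureState (Fin 2) × (Fin n → PureState (Fin 2)) → ℝ := fun p =>
    ‖expVal (Matrix.of fun a b => expVal (block A a b) (productVec p.2)) p.1.vec‖ ^ 2
  have hg : Continuous g := by
    simp only [g, expVal_eq_sum, of_apply]
    fun_prop
  have hmp := (measurePreserving_piFinSuccAbove
    (fun _ : Fin (n + 1) => haarState (Fin 2)) 0).integral_comp' (g := g)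
  have hL : ∫ ψ, ‖expVal A (productVec ψ)‖ ^ 2 ∂(haarProduct (n + 1)) =
      ∫ p, g p ∂((haarState (Fin 2)).prod (haarProduct n)) := by
    rw [haarProduct, haarProduct, ← hmp]
    refine integral_congr_ae (.of_forall fun ψ => ?_)
    simp only [g, expVal_productVec_succ]
    rfl
  have hi : Integrable g ((haarState (Fin 2)).prod (haarProduct n)) :=
    hg.integrable_of_hasCompactSupport (HasCompactSupport.of_compactSpace g)
  have hc : ∀ B : Op n, Integrable
      (fun ψ => ‖expVal B (productVec ψ)‖ ^ 2) (haarProduct n) := fun B =>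
    integrable_haarProduct ((continuous_expVal_productVec B).norm.pow 2)
  rw [hL, integral_prod_symm _ hi]
  simp only [g, haarState_secondMoment_qubit, of_apply, ← expVal_add, ← expVal_sub]
  have i₁ : Integrable (fun ψ => ‖expVal (block A 0 0 + block A 1 1) (productVec ψ)‖ ^ 2 / 4 +
      ‖expVal (block A 0 0 - block A 1 1) (productVec ψ)‖ ^ 2 / 12) (haarProduct n) :=
    ((hc _).div_const _).add ((hc _).div_const _)
  have i₂ : Integrable (fun ψ => (‖expVal (block A 0 1) (productVec ψ)‖ ^ 2 +
      ‖expVal (block A 1 0) (productVec ψ)‖ ^ 2) / 6) (haarProduct n) :=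
    ((hc _).add (hc _)).div_const _
  rw [integral_add i₁ i₂, integral_add ((hc _).div_const _) ((hc _).div_const _),
    integral_div, integral_div, integral_div, integral_add (hc _) (hc _)]

/-- The second moment over random product states is bounded by the Frobenius norm and the trace. -/
theorem haarProduct_secondMoment_le (n : ℕ) (A : Op n) :
    ∫ ψ, ‖expVal A (productVec ψ)‖ ^ 2 ∂(haarProduct n) ≤
      frobSq A / (3 * 2 ^ n) + 2 * ‖trace A‖ ^ 2 / (3 * (2 ^ n) ^ 2) := by
  induction n with
  | zero =>
    simp only [expVal_eq_sum, frobSq, trace, Fintype.sum_unique, productVec, Fin.prod_univ_zero,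
      diag_apply, star_one, one_mul, mul_one, integral_const, probReal_univ, smul_eq_mul, pow_zero]
    apply le_of_eq; ring
  | succ n ih =>
    have hweak : ∀ B : Op n, ∫ ψ, ‖expVal B (productVec ψ)‖ ^ 2 ∂(haarProduct n) ≤
        frobSq B / 2 ^ n := fun B => by
      refine (ih B).trans ?_
      have h := norm_trace_sq_le B
      simp only [Fintype.card_pi, Fintype.card_fin, Finset.prod_const, Finset.card_univ,
        Nat.cast_pow, Nat.cast_ofNat] at h
      have hp : (0 : ℝ) < 2 ^ n := by positivity
      rw [div_add_div _ _ (by positivity) (by positivity), div_le_div_iff₀ (by positivity) hp]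
      nlinarith [mul_le_mul_of_nonneg_left h (by positivity : (0 : ℝ) ≤ 6 * (2 ^ n) ^ 2)]
    rw [integral_haarProduct_succ]
    have h1 := ih (block A 0 0 + block A 1 1)
    have h2 := hweak (block A 0 0 - block A 1 1)
    have h3 := hweak (block A 0 1)
    have h4 := hweak (block A 1 0)
    have hp := frobSq_parallelogram (block A 0 0) (block A 1 1)
    rw [frobSq_eq_sum_block, trace_eq_sum_block]
    simp only [Fin.sum_univ_two]
    rw [trace_add] at h1
    set p : ℝ := 2 ^ n with hpdef
    have hpp : 0 < p := by positivity
    rw [pow_succ, ← hpdef]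
    set s := frobSq (block A 0 0 - block A 1 1)
    have hs : frobSq (block A 0 0 + block A 1 1) =
      2 * (frobSq (block A 0 0) + frobSq (block A 1 1)) - s := by linarith
    rw [hs] at h1
    refine (add_le_add (add_le_add (div_le_div_of_nonneg_right h1 (by norm_num))
      (div_le_div_of_nonneg_right h2 (by norm_num)))
      (div_le_div_of_nonneg_right (add_le_add h3 h4) (by norm_num))).trans (le_of_eq ?_)
    field_simp
    ring

end QSim

namespace QSim

open scoped Matrix.Norms.L2Operator

variable {n : ℕ}

/-- The tensor product of single-qubit operators. -/
def tensorOp (A : Fin n → Matrix (Fin 2) (Fin 2) ℂ) : Op n :=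
  Matrix.of fun x y => ∏ i, A i (x i) (y i)

theorem tensorOp_mul (A B : Fin n → Matrix (Fin 2) (Fin 2) ℂ) :
    tensorOp A * tensorOp B = tensorOp fun i => A i * B i := by
  ext x y
  simp only [tensorOp, mul_apply, of_apply, Finset.prod_univ_sum, Fintype.piFinset_univ,
    Finset.prod_mul_distrib]

theorem tensorOp_conjTranspose (A : Fin n → Matrix (Fin 2) (Fin 2) ℂ) :
    (tensorOp A)ᴴ = tensorOp fun i => (A i)ᴴ := by
  ext x y
  simp [tensorOp, conjTranspose_apply]

theorem tensorOp_one : tensorOp (fun _ : Fin n => 1) = 1 := by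
  ext x y
  simp only [tensorOp, of_apply, one_apply]
  rw [Finset.prod_ite_zero]
  simp [funext_iff]

theorem onQubit_eq_tensorOp (i : Fin n) (A : Matrix (Fin 2) (Fin 2) ℂ) :
    onQubit i A = tensorOp fun j => if j = i then A else 1 := by
  ext x y
  simp only [onQubit, tensorOp, of_apply]
  rw [← Finset.mul_prod_erase _ _ (Finset.mem_univ i)]
  have : ∏ j ∈ Finset.univ.erase i, (if j = i then A else 1) (x j) (y j) =
      ∏ j ∈ Finset.univ.erase i, if x j = y j then (1 : ℂ) else 0 :=
    Finset.prod_congr rfl fun j hj => by simp [Finset.ne_of_mem_erase hj, one_apply]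
  rw [this, Finset.prod_ite_zero]
  simp

theorem ketbra_productVec (ψ : Fin n → PureState (Fin 2)) :
    ketbra (productVec ψ) = tensorOp fun i => ketbra (ψ i).vec := by
  ext x y
  simp [ketbra, tensorOp, vecMulVec_apply, productVec, Finset.prod_mul_distrib]

theorem star_dotProduct_self {ι : Type} [Fintype ι] (v : ι → ℂ) :
    star v ⬝ᵥ v = ((∑ i, ‖v i‖ ^ 2 : ℝ) : ℂ) := by
  simp only [dotProduct, Complex.ofReal_sum]
  refine Finset.sum_congr rfl fun i _ => ?_
  rw [mul_comm]
  simp [Complex.mul_conj, Complex.normSq_eq_norm_sq]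

theorem isStarProjection_ketbra {ι : Type} [Fintype ι] (ψ : PureState ι) :
    IsStarProjection (ketbra ψ.vec) := by
  refine ⟨?_, ?_⟩
  · rw [IsIdempotentElem, ketbra, vecMulVec_mul_vecMulVec, star_dotProduct_self, sum_normSq_vec]
    simp
  · rw [IsSelfAdjoint, star_eq_conjTranspose, ketbra, conjTranspose_vecMulVec, star_star]

/-- The projection onto the states that agree with `ψ` on the qubits in `S`. -/
def agreeProj (ψ : Fin n → PureState (Fin 2)) (S : Finset (Fin n)) : Op n :=
  tensorOp fun i => if i ∈ S then ketbra (ψ i).vec else 1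

theorem isStarProjection_agreeProj (ψ : Fin n → PureState (Fin 2)) (S : Finset (Fin n)) :
    IsStarProjection (agreeProj ψ S) := by
  refine ⟨?_, ?_⟩
  · rw [IsIdempotentElem, agreeProj, tensorOp_mul]
    congr 1
    ext1 i
    split_ifs
    · exact (isStarProjection_ketbra (ψ i)).isIdempotentElem
    · simp
  · rw [IsSelfAdjoint, star_eq_conjTranspose, agreeProj, tensorOp_conjTranspose]
    congr 1
    ext1 i
    split_ifs
    · exact (isStarProjection_ketbra (ψ i)).isSelfAdjoint
    · simp

theorem agreeProj_mul (ψ : Fin n → PureState (Fin 2)) {S T : Finset (Fin n)} (h : Disjoint S T) :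
    agreeProj ψ S * agreeProj ψ T = agreeProj ψ (S ∪ T) := by
  rw [agreeProj, agreeProj, agreeProj, tensorOp_mul]
  congr 1
  ext1 i
  have : i ∈ S → i ∉ T := fun hS hT => Finset.disjoint_left.1 h hS hT
  by_cases h1 : i ∈ S <;> by_cases h2 : i ∈ T <;> simp_all

theorem agreeProj_empty (ψ : Fin n → PureState (Fin 2)) : agreeProj ψ ∅ = 1 := by
  simp [agreeProj, tensorOp_one]

theorem agreeProj_univ (ψ : Fin n → PureState (Fin 2)) :
    agreeProj ψ Finset.univ = ketbra (productVec ψ) := by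
  simp [agreeProj, ketbra_productVec]

theorem onQubit_ketbra (ψ : Fin n → PureState (Fin 2)) (i : Fin n) :
    onQubit i (ketbra (ψ i).vec) = agreeProj ψ {i} := by
  rw [onQubit_eq_tensorOp, agreeProj]
  congr 1
  ext1 j
  by_cases h : j = i
  · subst h; simp
  · simp [h]

/-- The Euclidean norm of a coordinate vector. -/
noncomputable def vecNorm {ι : Type} [Fintype ι] (v : ι → ℂ) : ℝ := ‖WithLp.toLp 2 v‖

theorem vecNorm_sq {ι : Type} [Fintype ι] (v : ι → ℂ) : vecNorm v ^ 2 = (star v ⬝ᵥ v).re := by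
  rw [vecNorm, EuclideanSpace.norm_sq_eq, star_dotProduct_self, Complex.ofReal_re]

theorem vecNorm_nonneg {ι : Type} [Fintype ι] (v : ι → ℂ) : 0 ≤ vecNorm v := norm_nonneg _

theorem vecNorm_mulVec_le {ι : Type} [Fintype ι] [DecidableEq ι] (A : Matrix ι ι ℂ) (v : ι → ℂ) :
    vecNorm (A *ᵥ v) ≤ ‖A‖ * vecNorm v :=
  l2_opNorm_mulVec A (WithLp.toLp 2 v)

theorem vecNorm_mulVec_unitary {ι : Type} [Fintype ι] [DecidableEq ι] {W : Matrix ι ι ℂ}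
    (hW : W ∈ unitaryGroup ι ℂ) (v : ι → ℂ) : vecNorm (W *ᵥ v) = vecNorm v := by
  rw [← sq_eq_sq₀ (vecNorm_nonneg _) (vecNorm_nonneg _), vecNorm_sq, vecNorm_sq]
  have := star_mulVec_dotProduct W 1 v
  rw [one_mulVec, Matrix.mul_one, show Wᴴ * W = 1 from mem_unitaryGroup_iff'.1 hW,
    one_mulVec] at this
  rw [this]

theorem vecNorm_productVec (ψ : Fin n → PureState (Fin 2)) : vecNorm (productVec ψ) = 1 := by
  have h : vecNorm (productVec ψ) ^ 2 = 1 := by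
    rw [vecNorm, EuclideanSpace.norm_sq_eq]
    simp only [productVec, norm_prod, ← Finset.prod_pow]
    have := Finset.prod_univ_sum (fun _ : Fin n => (Finset.univ : Finset (Fin 2)))
      (fun i a => ‖(ψ i).vec a‖ ^ 2)
    rw [Fintype.piFinset_univ] at this
    rw [← this]
    simp only [sum_normSq_vec, Finset.prod_const_one]
  exact (pow_eq_one_iff_of_nonneg (vecNorm_nonneg _) two_ne_zero).1 h

theorem re_expVal_starProjection {ι : Type} [Fintype ι] [DecidableEq ι] {R : Matrix ι ι ℂ}
    (hR : IsStarProjection R) (v : ι → ℂ) : (expVal R v).re = vecNorm (R *ᵥ v) ^ 2 := by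
  have h := star_mulVec_dotProduct R 1 v
  have h2 : Rᴴ = R := hR.isSelfAdjoint
  rw [one_mulVec, Matrix.mul_one, h2, hR.isIdempotentElem.eq] at h
  rw [vecNorm_sq, h, expVal]

theorem expVal_one {ι : Type} [Fintype ι] [DecidableEq ι] (v : ι → ℂ) :
    (expVal 1 v).re = vecNorm v ^ 2 := by
  rw [expVal, one_mulVec, vecNorm_sq]

/-- Union bound for the commuting projections onto the single-qubit factors of `ψ`. -/
theorem agreeProj_union_bound (ψ : Fin n → PureState (Fin 2)) {φ : Bits n → ℂ}
    (S : Finset (Fin n)) :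
    vecNorm φ ^ 2 - (expVal (agreeProj ψ S) φ).re ≤
      ∑ i ∈ S, vecNorm ((1 - agreeProj ψ {i}) *ᵥ φ) ^ 2 := by
  induction S using Finset.induction_on with
  | empty => simp [agreeProj_empty, expVal_one]
  | insert i S hi ih =>
    rw [Finset.sum_insert hi]
    have hP := isStarProjection_agreeProj ψ {i}
    have hQ := isStarProjection_agreeProj ψ S
    have hm : agreeProj ψ {i} * agreeProj ψ S = agreeProj ψ (insert i S) := by
      rw [agreeProj_mul ψ (by simpa using hi), Finset.insert_eq]
    have hm' : agreeProj ψ S * agreeProj ψ {i} = agreeProj ψ (insert i S) := by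
      rw [agreeProj_mul ψ (by simpa using hi), Finset.insert_eq, Finset.union_comm]
    have hR : IsStarProjection ((1 - agreeProj ψ {i}) * (1 - agreeProj ψ S)) := by
      refine hP.one_sub.mul hQ.one_sub ?_
      exact (Commute.one_left _).sub_left ((Commute.one_right _).sub_right (hm.trans hm'.symm))
    have h1 := re_expVal_starProjection hR φ
    have h2 := re_expVal_starProjection hP.one_sub φ
    rw [sub_mul, one_mul, mul_sub, mul_one, hm] at h1
    simp only [expVal_sub, Complex.sub_re, expVal_one] at h1 h2
    nlinarith [sq_nonneg (vecNorm
      ((1 - agreeProj ψ S - (agreeProj ψ {i} - agreeProj ψ (insert i S))) *ᵥ φ))]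

theorem trace_ketbra_mul {ι : Type} [Fintype ι] (v : ι → ℂ) (A : Matrix ι ι ℂ) :
    trace (ketbra v * A) = expVal A v := by
  rw [trace_mul_comm, ketbra, mul_vecMulVec, trace_vecMulVec, dotProduct_comm, expVal]

theorem conj_ketbra {ι : Type} [Fintype ι] (V : Matrix ι ι ℂ) (v : ι → ℂ) :
    Vᴴ * ketbra v * V = ketbra (Vᴴ *ᵥ v) := by
  rw [ketbra, mul_vecMulVec, vecMulVec_mul, ketbra, star_mulVec, conjTranspose_conjTranspose]

theorem vecNorm_output {U V : Op n} (hU : U ∈ unitaryGroup (Bits n) ℂ)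
    (hV : V ∈ unitaryGroup (Bits n) ℂ) (ψ : Fin n → PureState (Fin 2)) :
    vecNorm (Vᴴ *ᵥ (U *ᵥ productVec ψ)) = 1 := by
  rw [← star_eq_conjTranspose, vecNorm_mulVec_unitary (Unitary.star_mem hV),
    vecNorm_mulVec_unitary hU, vecNorm_productVec]

theorem localLoss_eq (hn : 1 ≤ n) {U V : Op n} (hU : U ∈ unitaryGroup (Bits n) ℂ)
    (hV : V ∈ unitaryGroup (Bits n) ℂ) (ψ : Fin n → PureState (Fin 2)) :
    localLoss U V ψ = (1 / (n : ℝ)) *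
      ∑ i, vecNorm ((1 - agreeProj ψ {i}) *ᵥ (Vᴴ *ᵥ (U *ᵥ productVec ψ))) ^ 2 := by
  set φ := Vᴴ *ᵥ (U *ᵥ productVec ψ) with hφ
  have hφ1 : vecNorm φ = 1 := vecNorm_output hU hV ψ
  have h1 : ∀ i, vecNorm ((1 - agreeProj ψ {i}) *ᵥ φ) ^ 2 =
      1 - (expVal (agreeProj ψ {i}) φ).re := fun i => by
    rw [← re_expVal_starProjection (isStarProjection_agreeProj ψ {i}).one_sub, expVal_sub,
      Complex.sub_re, expVal_one, hφ1, one_pow]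
  have h2 : (expVal (∑ i, agreeProj ψ {i}) φ) = ∑ i, expVal (agreeProj ψ {i}) φ := by
    simp only [expVal, sum_mulVec, dotProduct_sum]
  have hn0 : (n : ℝ) ≠ 0 := by positivity
  rw [localLoss, conj_ketbra, trace_ketbra_mul, localObservable, expVal_sub, Complex.sub_re,
    expVal_one, ← hφ, hφ1]
  simp only [onQubit_ketbra, h1]
  have h3 : expVal ((1 / (n : ℂ)) • ∑ i, agreeProj ψ {i}) φ =
      (1 / (n : ℝ) : ℝ) * ∑ i, expVal (agreeProj ψ {i}) φ := by
    rw [← h2, expVal, smul_mulVec, dotProduct_smul, expVal]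
    simp
  rw [h3, Complex.re_ofReal_mul, Complex.re_sum, Finset.sum_sub_distrib]
  simp
  field_simp

theorem localLoss_nonneg (hn : 1 ≤ n) {U V : Op n} (hU : U ∈ unitaryGroup (Bits n) ℂ)
    (hV : V ∈ unitaryGroup (Bits n) ℂ) (ψ : Fin n → PureState (Fin 2)) : 0 ≤ localLoss U V ψ := by
  rw [localLoss_eq hn hU hV]
  positivity

/-- The infidelity of the output is controlled by the local loss. -/
theorem one_sub_fidelity_le (hn : 1 ≤ n) {U V : Op n} (hU : U ∈ unitaryGroup (Bits n) ℂ)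
    (hV : V ∈ unitaryGroup (Bits n) ℂ) (ψ : Fin n → PureState (Fin 2)) :
    1 - ‖expVal (Uᴴ * V) (productVec ψ)‖ ^ 2 ≤ n * localLoss U V ψ := by
  have h := agreeProj_union_bound ψ (φ := Vᴴ *ᵥ (U *ᵥ productVec ψ)) Finset.univ
  have hn0 : (n : ℝ) ≠ 0 := by positivity
  rw [localLoss_eq hn hU hV, ← mul_assoc, mul_one_div_cancel hn0, one_mul]
  refine le_trans (le_of_eq ?_) h
  rw [vecNorm_output hU hV, one_pow, agreeProj_univ]
  congr 1
  set Ψ := productVec ψ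
  set φ := Vᴴ *ᵥ (U *ᵥ Ψ) with hφ
  have h1 : expVal (Uᴴ * V) Ψ = star φ ⬝ᵥ Ψ := by
    rw [expVal, hφ, star_mulVec, star_mulVec, conjTranspose_conjTranspose, vecMul_vecMul,
      dotProduct_mulVec]
  have h2 : expVal (ketbra Ψ) φ = (star φ ⬝ᵥ Ψ) * star (star φ ⬝ᵥ Ψ) := by
    have h3 : star (star φ ⬝ᵥ Ψ) = star Ψ ⬝ᵥ φ := by rw [star_dotProduct, star_star]
    rw [expVal, ketbra, vecMulVec_mulVec, h3, dotProduct_smul]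
    simp
  rw [h2, h1, ← Complex.normSq_eq_norm_sq]
  simp [Complex.mul_conj]

theorem norm_le_one_of_isStarProjection {ι : Type} [Fintype ι] [DecidableEq ι] {R : Matrix ι ι ℂ}
    (hR : IsStarProjection R) : ‖R‖ ≤ 1 := by
  have h := l2_opNorm_conjTranspose_mul_self R
  rw [show Rᴴ = R from hR.isSelfAdjoint, hR.isIdempotentElem.eq] at h
  nlinarith [norm_nonneg R]

theorem vecNorm_residual_le {U V : Op n} (hU : U ∈ unitaryGroup (Bits n) ℂ)
    (hV : V ∈ unitaryGroup (Bits n) ℂ) (ψ : Fin n → PureState (Fin 2)) (i : Fin n) :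
    vecNorm ((1 - agreeProj ψ {i}) *ᵥ (Vᴴ *ᵥ (U *ᵥ productVec ψ))) ≤ 1 := by
  have h := vecNorm_mulVec_le (1 - agreeProj ψ {i}) (Vᴴ *ᵥ (U *ᵥ productVec ψ))
  rw [vecNorm_output hU hV, mul_one] at h
  exact h.trans (norm_le_one_of_isStarProjection (isStarProjection_agreeProj ψ {i}).one_sub)

theorem localLoss_le_one (hn : 1 ≤ n) {U V : Op n} (hU : U ∈ unitaryGroup (Bits n) ℂ)
    (hV : V ∈ unitaryGroup (Bits n) ℂ) (ψ : Fin n → PureState (Fin 2)) : localLoss U V ψ ≤ 1 := by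
  rw [localLoss_eq hn hU hV]
  have : ∀ i, vecNorm ((1 - agreeProj ψ {i}) *ᵥ (Vᴴ *ᵥ (U *ᵥ productVec ψ))) ^ 2 ≤ 1 := fun i =>
    pow_le_one₀ (vecNorm_nonneg _) (vecNorm_residual_le hU hV ψ i)
  have hn0 : (0 : ℝ) < n := by positivity
  calc _ ≤ (1 / (n : ℝ)) * ∑ i : Fin n, (1 : ℝ) := by gcongr with i; exact this i
    _ = 1 := by simp; field_simp

theorem abs_sq_vecNorm_sub_le {ι : Type} [Fintype ι] (v w : ι → ℂ) (hv : vecNorm v ≤ 1)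
    (hw : vecNorm w ≤ 1) : |vecNorm v ^ 2 - vecNorm w ^ 2| ≤ 2 * vecNorm (v - w) := by
  have h : |vecNorm v - vecNorm w| ≤ vecNorm (v - w) := abs_norm_sub_norm_le _ _
  rw [sq_sub_sq, abs_mul, abs_of_nonneg (add_nonneg (vecNorm_nonneg v) (vecNorm_nonneg w))]
  exact mul_le_mul (by linarith) h (abs_nonneg _) (by norm_num)

theorem abs_localLoss_sub_le (hn : 1 ≤ n) {U V V' : Op n} (hU : U ∈ unitaryGroup (Bits n) ℂ)
    (hV : V ∈ unitaryGroup (Bits n) ℂ) (hV' : V' ∈ unitaryGroup (Bits n) ℂ)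
    (ψ : Fin n → PureState (Fin 2)) :
    |localLoss U V ψ - localLoss U V' ψ| ≤ 2 * ‖V - V'‖ := by
  have hn0 : (0 : ℝ) < n := by positivity
  rw [localLoss_eq hn hU hV, localLoss_eq hn hU hV', ← mul_sub, ← Finset.sum_sub_distrib, abs_mul,
    abs_of_pos (by positivity)]
  have hR : ∀ i, ‖1 - agreeProj ψ {i}‖ ≤ 1 := fun i =>
    norm_le_one_of_isStarProjection (isStarProjection_agreeProj ψ {i}).one_sub
  have hterm : ∀ i, |vecNorm ((1 - agreeProj ψ {i}) *ᵥ (Vᴴ *ᵥ (U *ᵥ productVec ψ))) ^ 2 -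
      vecNorm ((1 - agreeProj ψ {i}) *ᵥ (V'ᴴ *ᵥ (U *ᵥ productVec ψ))) ^ 2| ≤
      2 * ‖V - V'‖ := fun i => by
    refine (abs_sq_vecNorm_sub_le _ _ (vecNorm_residual_le hU hV ψ i)
      (vecNorm_residual_le hU hV' ψ i)).trans ?_
    rw [← mulVec_sub, ← sub_mulVec, ← conjTranspose_sub]
    gcongr
    calc _ ≤ ‖1 - agreeProj ψ {i}‖ * vecNorm ((V - V')ᴴ *ᵥ (U *ᵥ productVec ψ)) :=
          vecNorm_mulVec_le _ _
      _ ≤ 1 * (‖(V - V')ᴴ‖ * vecNorm (U *ᵥ productVec ψ)) := by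
          gcongr
          · exact vecNorm_nonneg _
          · exact hR i
          · exact vecNorm_mulVec_le _ _
      _ = _ := by
          rw [vecNorm_mulVec_unitary hU, vecNorm_productVec, l2_opNorm_conjTranspose]
          ring
  calc _ ≤ (1 / (n : ℝ)) * ∑ i : Fin n, (2 * ‖V - V'‖) := by
        gcongr
        exact (Finset.abs_sum_le_sum_abs _ _).trans (Finset.sum_le_sum fun i _ => hterm i)
    _ = _ := by simp; field_simp

end QSim

namespace QSim

variable {n : ℕ}

section frobenius

variable {ι : Type} [Fintype ι]

/-- The Frobenius norm, as the Euclidean norm of the vector of entries. -/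
noncomputable def hsNorm (A : Matrix ι ι ℂ) : ℝ :=
  ‖(WithLp.toLp 2 fun p : ι × ι => A p.1 p.2 : EuclideanSpace ℂ (ι × ι))‖

theorem hsNorm_sq (A : Matrix ι ι ℂ) : hsNorm A ^ 2 = frobSq A := by
  rw [hsNorm, EuclideanSpace.norm_sq_eq, Fintype.sum_prod_type, frobSq]

theorem hsNorm_nonneg (A : Matrix ι ι ℂ) : 0 ≤ hsNorm A := norm_nonneg _

theorem hsNorm_add_le (A B : Matrix ι ι ℂ) : hsNorm (A + B) ≤ hsNorm A + hsNorm B := by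
  have h : (WithLp.toLp 2 fun p : ι × ι => (A + B) p.1 p.2 : EuclideanSpace ℂ (ι × ι)) =
      WithLp.toLp 2 (fun p : ι × ι => A p.1 p.2) + WithLp.toLp 2 fun p : ι × ι => B p.1 p.2 := by
    ext p; simp
  rw [hsNorm, h]
  exact norm_add_le _ _

variable [DecidableEq ι]

theorem frobSq_unitary {A : Matrix ι ι ℂ} (hA : A ∈ unitaryGroup ι ℂ) :
    frobSq A = Fintype.card ι := by
  have h := trace_conjTranspose_mul_self A
  rw [show Aᴴ * A = 1 from mem_unitaryGroup_iff'.1 hA, trace_one] at h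
  exact_mod_cast h.symm

theorem frobSq_unitary_mul {W : Matrix ι ι ℂ} (hW : W ∈ unitaryGroup ι ℂ) (A : Matrix ι ι ℂ) :
    frobSq (W * A) = frobSq A := by
  have h := trace_conjTranspose_mul_self (W * A)
  rw [conjTranspose_mul, Matrix.mul_assoc, ← Matrix.mul_assoc Wᴴ,
    show Wᴴ * W = 1 from mem_unitaryGroup_iff'.1 hW, Matrix.one_mul,
    trace_conjTranspose_mul_self] at h
  exact_mod_cast h.symm

theorem frobSq_mul_unitary {W : Matrix ι ι ℂ} (hW : W ∈ unitaryGroup ι ℂ) (A : Matrix ι ι ℂ) :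
    frobSq (A * W) = frobSq A := by
  have h := trace_conjTranspose_mul_self (A * W)
  rw [trace_mul_comm, conjTranspose_mul, Matrix.mul_assoc, ← Matrix.mul_assoc W,
    show W * Wᴴ = 1 from mem_unitaryGroup_iff.1 hW, Matrix.one_mul, trace_mul_comm,
    trace_conjTranspose_mul_self] at h
  exact_mod_cast h.symm

theorem hsNorm_unitary_mul {W : Matrix ι ι ℂ} (hW : W ∈ unitaryGroup ι ℂ) (A : Matrix ι ι ℂ) :
    hsNorm (W * A) = hsNorm A := by
  rw [← sq_eq_sq₀ (hsNorm_nonneg _) (hsNorm_nonneg _), hsNorm_sq, hsNorm_sq, frobSq_unitary_mul hW]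

theorem hsNorm_mul_unitary {W : Matrix ι ι ℂ} (hW : W ∈ unitaryGroup ι ℂ) (A : Matrix ι ι ℂ) :
    hsNorm (A * W) = hsNorm A := by
  rw [← sq_eq_sq₀ (hsNorm_nonneg _) (hsNorm_nonneg _), hsNorm_sq, hsNorm_sq, frobSq_mul_unitary hW]

theorem hsNorm_pow_sub_pow_le {W X : Matrix ι ι ℂ} (hW : W ∈ unitaryGroup ι ℂ)
    (hX : X ∈ unitaryGroup ι ℂ) (M : ℕ) : hsNorm (W ^ M - X ^ M) ≤ M * hsNorm (W - X) := by
  induction M with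
  | zero =>
    have h : hsNorm (0 : Matrix ι ι ℂ) ^ 2 = 0 := by rw [hsNorm_sq]; simp [frobSq]
    simp [pow_eq_zero_iff two_ne_zero |>.1 h]
  | succ M ih =>
    have h : W ^ (M + 1) - X ^ (M + 1) = W ^ M * (W - X) + (W ^ M - X ^ M) * X := by
      rw [pow_succ, pow_succ, mul_sub, sub_mul]; abel
    rw [h]
    refine (hsNorm_add_le _ _).trans ?_
    rw [hsNorm_unitary_mul (pow_mem hW M), hsNorm_mul_unitary hX]
    push_cast
    linarith

theorem frobSq_sub_unitary {A B : Matrix ι ι ℂ} (hA : A ∈ unitaryGroup ι ℂ)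
    (hB : B ∈ unitaryGroup ι ℂ) :
    frobSq (A - B) = 2 * Fintype.card ι - 2 * (trace (Aᴴ * B)).re := by
  have h := congrArg Complex.re (trace_conjTranspose_mul_self (A - B))
  have hc : trace (Bᴴ * A) = star (trace (Aᴴ * B)) := by
    rw [← trace_conjTranspose, conjTranspose_mul, conjTranspose_conjTranspose]
  rw [Complex.ofReal_re, conjTranspose_sub, sub_mul, mul_sub, mul_sub,
    show Aᴴ * A = 1 from mem_unitaryGroup_iff'.1 hA,
    show Bᴴ * B = 1 from mem_unitaryGroup_iff'.1 hB] at h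
  rw [← h, trace_sub, trace_sub, trace_sub, hc, trace_one]
  simp
  ring

theorem exists_phase (z : ℂ) : ∃ c : ℂ, ‖c‖ = 1 ∧ c * z = ‖z‖ := by
  by_cases hz : z = 0
  · exact ⟨1, by simp, by simp [hz]⟩
  · have hz' : (‖z‖ : ℂ) ≠ 0 := by simpa using hz
    refine ⟨star z / ‖z‖, by simp [hz], ?_⟩
    have : star z * z = (‖z‖ : ℂ) ^ 2 := Complex.conj_mul' z
    rw [div_mul_eq_mul_div, this]
    field_simp

theorem smul_mem_unitaryGroup {c : ℂ} (hc : ‖c‖ = 1) {A : Matrix ι ι ℂ}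
    (hA : A ∈ unitaryGroup ι ℂ) : c • A ∈ unitaryGroup ι ℂ := by
  rw [mem_unitaryGroup_iff, star_smul, smul_mul_smul_comm, mem_unitaryGroup_iff.1 hA]
  have : c * star c = 1 := by simp [Complex.mul_conj, Complex.normSq_eq_norm_sq, hc]
  rw [this, one_smul]

end frobenius

theorem card_bits (n : ℕ) : (Fintype.card (Bits n) : ℝ) = 2 ^ n := by simp

theorem schattenTwoNorm_sq (A : Op n) : schattenTwoNorm A ^ 2 = hsNorm A ^ 2 := by
  have h : 0 ≤ frobSq A := by rw [← hsNorm_sq]; positivity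
  rw [schattenTwoNorm, trace_conjTranspose_mul_self, Complex.ofReal_re, Real.sq_sqrt h, hsNorm_sq]

theorem evolution_mem_unitaryGroup {H : Op n} (hH : H.IsHermitian) (t : ℝ) :
    evolution H t ∈ unitaryGroup (Bits n) ℂ := by
  rw [mem_unitaryGroup_iff, star_eq_conjTranspose, evolution, ← Matrix.exp_conjTranspose,
    conjTranspose_smul, hH.eq]
  have : star (-Complex.I * (t : ℂ)) • H = -((-Complex.I * (t : ℂ)) • H) := by
    rw [← neg_smul]
    congr 1
    simp
  rw [this, Matrix.exp_neg, Matrix.mul_nonsing_inv]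
  exact (Matrix.isUnit_iff_isUnit_det _).1 (Matrix.isUnit_exp _)

theorem evolution_nat_mul (H : Op n) (t : ℝ) (M : ℕ) :
    evolution H (M * t) = evolution H t ^ M := by
  rw [evolution, evolution, ← Matrix.exp_nsmul, ← Nat.cast_smul_eq_nsmul ℂ, smul_smul]
  congr 2
  push_cast
  ring

theorem avgFidelity_unitary {A B : Op n} (hA : A ∈ unitaryGroup (Bits n) ℂ)
    (hB : B ∈ unitaryGroup (Bits n) ℂ) :
    avgFidelity A B = (‖trace (Aᴴ * B)‖ ^ 2 + 2 ^ n) / (2 ^ n * (2 ^ n + 1)) := by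
  have hAB : Aᴴ * B ∈ unitaryGroup (Bits n) ℂ := mul_mem (Unitary.star_mem hA) hB
  rw [avgFidelity, haarState_secondMoment, trace_conjTranspose_mul_self, Complex.ofReal_re,
    frobSq_unitary hAB, card_bits]

theorem one_sub_avgFidelity_le {A B : Op n} (hA : A ∈ unitaryGroup (Bits n) ℂ)
    (hB : B ∈ unitaryGroup (Bits n) ℂ) {c : ℂ} (hc : ‖c‖ = 1) :
    1 - avgFidelity A B ≤ hsNorm (A - c • B) ^ 2 / (2 ^ n + 1) := by
  have hd : (0 : ℝ) < 2 ^ n := by positivity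
  rw [avgFidelity_unitary hA hB, hsNorm_sq, frobSq_sub_unitary hA (smul_mem_unitaryGroup hc hB),
    card_bits, Matrix.mul_smul, trace_smul]
  set z := trace (Aᴴ * B)
  set d : ℝ := 2 ^ n
  have hre : (c • z).re ≤ ‖z‖ := by
    refine (Complex.re_le_norm _).trans ?_
    rw [norm_smul, hc, one_mul]
  rw [one_sub_div (by positivity), div_le_div_iff₀ (by positivity) (by positivity)]
  have : d * (d + 1) - (‖z‖ ^ 2 + d) ≤ (2 * d - 2 * (c • z).re) * d := by
    nlinarith [sq_nonneg (‖z‖ - d)]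
  nlinarith

theorem continuous_localLoss (U V : Op n) : Continuous (localLoss U V) := by
  have h1 : Continuous fun ψ : Fin n → PureState (Fin 2) => ketbra (U *ᵥ productVec ψ) := by
    have : Continuous fun ψ : Fin n → PureState (Fin 2) => U *ᵥ productVec ψ :=
      continuous_const.matrix_mulVec continuous_productVec
    exact this.matrix_vecMulVec (continuous_star.comp this)
  have h2 : Continuous (localObservable : (Fin n → PureState (Fin 2)) → Op n) := by
    suffices hs : Continuous fun ψ : Fin n → PureState (Fin 2) =>
        ∑ i, onQubit i (ketbra (ψ i).vec) by
      have hc : Continuous fun ψ : Fin n → PureState (Fin 2) =>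
          (1 / (n : ℂ)) • ∑ i, onQubit i (ketbra (ψ i).vec) :=
        (continuous_const_smul (1 / (n : ℂ))).comp hs
      exact continuous_const.sub hc
    refine continuous_finsetSum _ fun i _ => continuous_matrix fun x y => ?_
    simp only [onQubit, of_apply]
    split_ifs
    · simp only [ketbra, vecMulVec_apply, Pi.star_apply]
      fun_prop
    · fun_prop
  exact Complex.continuous_re.comp
    (((continuous_const.matrix_mul h1).matrix_mul continuous_const).matrix_mul h2).matrix_trace

/-- The expected local loss over random product states. -/
noncomputable def expectedLoss (U V : Op n) : ℝ := ∫ ψ, localLoss U V ψ ∂(haarProduct n)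

theorem one_sub_trace_sq_le (hn : 1 ≤ n) {U V : Op n} (hU : U ∈ unitaryGroup (Bits n) ℂ)
    (hV : V ∈ unitaryGroup (Bits n) ℂ) :
    1 - ‖trace (Uᴴ * V)‖ ^ 2 / (2 ^ n) ^ 2 ≤ 3 / 2 * (n * expectedLoss U V) := by
  have hd : (0 : ℝ) < 2 ^ n := by positivity
  have h1 := haarProduct_secondMoment_le n (Uᴴ * V)
  have hUV : Uᴴ * V ∈ unitaryGroup (Bits n) ℂ := mul_mem (Unitary.star_mem hU) hV
  rw [frobSq_unitary hUV, card_bits] at h1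
  have hi : Integrable (fun ψ => ‖expVal (Uᴴ * V) (productVec ψ)‖ ^ 2) (haarProduct n) :=
    integrable_haarProduct ((continuous_expVal_productVec (Uᴴ * V)).norm.pow 2)
  have h2 : ∫ ψ, (1 - ‖expVal (Uᴴ * V) (productVec ψ)‖ ^ 2) ∂(haarProduct n) ≤
      ∫ ψ, n * localLoss U V ψ ∂(haarProduct n) :=
    integral_mono ((integrable_const _).sub hi)
      ((integrable_haarProduct (continuous_localLoss U V)).const_mul _)
      (one_sub_fidelity_le hn hU hV)
  rw [integral_sub (integrable_const _) hi, integral_const_mul] at h2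
  simp only [integral_const, probReal_univ, smul_eq_mul, one_mul] at h2
  unfold expectedLoss
  have h3 : (2 : ℝ) ^ n / (3 * 2 ^ n) = 1 / 3 := by field_simp
  have h4 : 2 * ‖trace (Uᴴ * V)‖ ^ 2 / (3 * ((2 : ℝ) ^ n) ^ 2) =
    2 / 3 * (‖trace (Uᴴ * V)‖ ^ 2 / (2 ^ n) ^ 2) := by field_simp
  rw [h3, h4] at h1
  linarith

theorem exists_phase_hsNorm_sq_le (hn : 1 ≤ n) {U V : Op n} (hU : U ∈ unitaryGroup (Bits n) ℂ)
    (hV : V ∈ unitaryGroup (Bits n) ℂ) :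
    ∃ c : ℂ, ‖c‖ = 1 ∧ hsNorm (U - c • V) ^ 2 ≤ 3 * 2 ^ n * (n * expectedLoss U V) := by
  obtain ⟨c, hc, hcz⟩ := exists_phase (trace (Uᴴ * V))
  refine ⟨c, hc, ?_⟩
  have h := one_sub_trace_sq_le hn hU hV
  have hUV : Uᴴ * V ∈ unitaryGroup (Bits n) ℂ := mul_mem (Unitary.star_mem hU) hV
  have hcs := norm_trace_sq_le (Uᴴ * V)
  rw [frobSq_unitary hUV, card_bits] at hcs
  rw [hsNorm_sq, frobSq_sub_unitary hU (smul_mem_unitaryGroup hc hV), card_bits, Matrix.mul_smul,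
    trace_smul, smul_eq_mul, hcz, Complex.ofReal_re]
  set z := ‖trace (Uᴴ * V)‖
  have hz : 0 ≤ z := norm_nonneg _
  have hd : (0 : ℝ) < 2 ^ n := by positivity
  set d : ℝ := 2 ^ n
  have hzd : z ≤ d := by nlinarith
  rw [one_sub_div (by positivity), div_le_iff₀ (by positivity)] at h
  have : (2 * d - 2 * z) * d ≤ 3 * d * (n * expectedLoss U V) * d := by nlinarith
  exact le_of_mul_le_mul_right this hd

theorem expectedLoss_nonneg (hn : 1 ≤ n) {U V : Op n} (hU : U ∈ unitaryGroup (Bits n) ℂ)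
    (hV : V ∈ unitaryGroup (Bits n) ℂ) : 0 ≤ expectedLoss U V :=
  integral_nonneg (localLoss_nonneg hn hU hV)

/-- Simulation fidelity in terms of the expected local loss. -/
theorem simFidelity_ge (hn : 1 ≤ n) {H : Op n} (hH : H.IsHermitian) (Δt : ℝ) {U V : Op n}
    (hU : U ∈ unitaryGroup (Bits n) ℂ) (hV : V ∈ unitaryGroup (Bits n) ℂ) (M : ℕ) :
    1 - 2 * (M : ℝ) ^ 2 * (schattenTwoNorm (U - evolution H Δt) ^ 2 / (2 ^ n + 1) +
      4 * n * expectedLoss U V) ≤ simFidelity H Δt M V := by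
  obtain ⟨c, hc, hUV⟩ := exists_phase_hsNorm_sq_le hn hU hV
  have hW := evolution_mem_unitaryGroup hH Δt
  set W := evolution H Δt with hWdef
  have hcM : ‖c ^ M‖ = 1 := by rw [norm_pow, hc, one_pow]
  have h1 := one_sub_avgFidelity_le (pow_mem hW M) (pow_mem hV M) hcM
  rw [← smul_pow] at h1
  have h2 := hsNorm_pow_sub_pow_le hW (smul_mem_unitaryGroup hc hV) M
  have h3 : hsNorm (W - c • V) ≤ hsNorm (U - W) + hsNorm (U - c • V) := by
    have := hsNorm_add_le (-(U - W)) (U - c • V)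
    have hneg : hsNorm (-(U - W)) = hsNorm (U - W) := by
      rw [← sq_eq_sq₀ (hsNorm_nonneg _) (hsNorm_nonneg _), hsNorm_sq, hsNorm_sq]
      simp only [frobSq, Matrix.neg_apply, norm_neg]
    rwa [hneg, neg_sub, sub_add_sub_cancel] at this
  rw [simFidelity, evolution_nat_mul, ← hWdef, schattenTwoNorm_sq]
  have hE := mul_nonneg (Nat.cast_nonneg (α := ℝ) n) (expectedLoss_nonneg hn hU hV)
  set x := hsNorm (U - W)
  set y := hsNorm (U - c • V)
  have hx : 0 ≤ x := hsNorm_nonneg _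
  have hy : 0 ≤ y := hsNorm_nonneg _
  have h4 : hsNorm (W ^ M - (c • V) ^ M) ^ 2 ≤ (M : ℝ) ^ 2 * (2 * x ^ 2 + 2 * y ^ 2) := by
    calc _ ≤ (M * (x + y)) ^ 2 := by
          refine pow_le_pow_left₀ (hsNorm_nonneg _) (h2.trans ?_) 2
          gcongr
      _ = (M : ℝ) ^ 2 * (x + y) ^ 2 := by ring
      _ ≤ _ := by gcongr; nlinarith [sq_nonneg (x - y)]
  have hd : (0 : ℝ) < 2 ^ n := by positivity
  set d : ℝ := 2 ^ n
  have h5 : hsNorm (W ^ M - (c • V) ^ M) ^ 2 / (d + 1) ≤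
      2 * (M : ℝ) ^ 2 * (x ^ 2 / (d + 1) + 4 * n * expectedLoss U V) := by
    rw [div_le_iff₀ (by positivity)]
    refine h4.trans ?_
    have : 2 * (M : ℝ) ^ 2 * (x ^ 2 / (d + 1) + 4 * n * expectedLoss U V) * (d + 1) =
      (M : ℝ) ^ 2 * (2 * x ^ 2 + 8 * (n * expectedLoss U V) * (d + 1)) := by field_simp; ring
    rw [this]
    exact mul_le_mul_of_nonneg_left (by nlinarith) (sq_nonneg _)
  linarith

end QSim

namespace QSim

open scoped Matrix.Norms.L2Operator Kronecker

variable {n : ℕ}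

theorem onQubits_eq_submatrix (S : Finset (Fin n)) (G : Matrix (S → Fin 2) (S → Fin 2) ℂ) :
    onQubits S G = (G ⊗ₖ (1 : Matrix ({i // i ∉ S} → Fin 2) ({i // i ∉ S} → Fin 2) ℂ)).submatrix
      (Equiv.piEquivPiSubtypeProd (· ∈ S) fun _ => Fin 2)
      (Equiv.piEquivPiSubtypeProd (· ∈ S) fun _ => Fin 2) := by
  ext x y
  simp only [onQubits, of_apply, submatrix_apply, kronecker_apply,
    Equiv.piEquivPiSubtypeProd_apply, one_apply, funext_iff, Subtype.forall]
  split_ifs <;> simp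

theorem onQubits_mul (S : Finset (Fin n)) (G G' : Matrix (S → Fin 2) (S → Fin 2) ℂ) :
    onQubits S (G * G') = onQubits S G * onQubits S G' := by
  simp only [onQubits_eq_submatrix, submatrix_mul_equiv, ← mul_kronecker_mul, Matrix.one_mul]

theorem onQubits_one (S : Finset (Fin n)) : onQubits S 1 = 1 := by
  rw [onQubits_eq_submatrix, one_kronecker_one, submatrix_one_equiv]

theorem onQubits_conjTranspose (S : Finset (Fin n)) (G : Matrix (S → Fin 2) (S → Fin 2) ℂ) :
    onQubits S Gᴴ = (onQubits S G)ᴴ := by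
  simp only [onQubits_eq_submatrix, conjTranspose_submatrix, conjTranspose_kronecker,
    conjTranspose_one]

theorem onQubits_mem_unitaryGroup (S : Finset (Fin n)) {G : Matrix (S → Fin 2) (S → Fin 2) ℂ}
    (hG : G ∈ unitaryGroup (S → Fin 2) ℂ) : onQubits S G ∈ unitaryGroup (Bits n) ℂ := by
  rw [mem_unitaryGroup_iff, star_eq_conjTranspose, ← onQubits_conjTranspose, ← onQubits_mul,
    show G * Gᴴ = 1 from mem_unitaryGroup_iff.1 hG, onQubits_one]

theorem onQubits_sub (S : Finset (Fin n)) (G G' : Matrix (S → Fin 2) (S → Fin 2) ℂ) :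
    onQubits S (G - G') = onQubits S G - onQubits S G' := by
  ext x y
  simp only [onQubits, of_apply, Matrix.sub_apply]
  split_ifs <;> simp

theorem onQubits_eq_sum (S : Finset (Fin n)) (G : Matrix (S → Fin 2) (S → Fin 2) ℂ) :
    onQubits S G = ∑ a, ∑ b, G a b • onQubits S (single a b 1) := by
  ext x y
  simp only [Matrix.sum_apply, Matrix.smul_apply, onQubits, of_apply, smul_ite, smul_zero]
  split_ifs with h
  · simp [single_apply, ite_and]
  · simp

theorem norm_onQubits_single_le (S : Finset (Fin n)) (a b : S → Fin 2) :
    ‖onQubits S (single a b 1)‖ ≤ 1 := by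
  have hP : IsStarProjection (onQubits S (single b b 1)) := by
    refine ⟨?_, ?_⟩
    · rw [IsIdempotentElem, ← onQubits_mul, single_mul_single_same, mul_one]
    · rw [IsSelfAdjoint, star_eq_conjTranspose, ← onQubits_conjTranspose, conjTranspose_single,
        star_one]
  have h := l2_opNorm_conjTranspose_mul_self (onQubits S (single a b 1))
  rw [← onQubits_conjTranspose, conjTranspose_single, star_one, ← onQubits_mul,
    single_mul_single_same, mul_one] at h
  have h1 := norm_le_one_of_isStarProjection hP
  nlinarith [norm_nonneg (onQubits S (single a b 1))]

theorem norm_onQubits_le (S : Finset (Fin n)) (G : Matrix (S → Fin 2) (S → Fin 2) ℂ) :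
    ‖onQubits S G‖ ≤ ∑ a, ∑ b, ‖G a b‖ := by
  rw [onQubits_eq_sum]
  refine (norm_sum_le _ _).trans (Finset.sum_le_sum fun a _ => (norm_sum_le _ _).trans
    (Finset.sum_le_sum fun b _ => ?_))
  rw [norm_smul]
  exact mul_le_of_le_one_right (norm_nonneg _) (norm_onQubits_single_le S a b)

/-- The cell of `[-1, 1]`, cut into pieces of length `1 / q`, that contains `x`. -/
noncomputable def cell (q : ℕ) (x : ℝ) : Fin (2 * q + 1) :=
  ⟨⌊(q : ℝ) * (x + 1)⌋₊ % (2 * q + 1), Nat.mod_lt _ (by omega)⟩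

theorem abs_sub_le_of_cell_eq {q : ℕ} (hq : 0 < q) {x y : ℝ} (hx : |x| ≤ 1) (hy : |y| ≤ 1)
    (h : cell q x = cell q y) : |x - y| ≤ 1 / q := by
  have hq' : (0 : ℝ) < q := by exact_mod_cast hq
  have hlt : ∀ z : ℝ, |z| ≤ 1 → 0 ≤ (q : ℝ) * (z + 1) ∧ ⌊(q : ℝ) * (z + 1)⌋₊ < 2 * q + 1 := by
    intro z hz
    have hz' := abs_le.1 hz
    have h0 : 0 ≤ (q : ℝ) * (z + 1) := mul_nonneg hq'.le (by linarith)
    refine ⟨h0, ?_⟩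
    rw [Nat.floor_lt h0]
    push_cast
    nlinarith
  have hv := congrArg Fin.val h
  simp only [cell] at hv
  rw [Nat.mod_eq_of_lt (hlt x hx).2, Nat.mod_eq_of_lt (hlt y hy).2] at hv
  have h1 := Nat.floor_le (hlt x hx).1
  have h2 := Nat.floor_le (hlt y hy).1
  have h3 := Nat.lt_floor_add_one ((q : ℝ) * (x + 1))
  have h4 := Nat.lt_floor_add_one ((q : ℝ) * (y + 1))
  rw [hv] at h1 h3
  have h5 : |x - y| * q = |(x - y) * q| := by rw [abs_mul, abs_of_pos hq']
  rw [le_div_iff₀ hq', h5, abs_le]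
  constructor <;> nlinarith

theorem Gate.op_mem_unitaryGroup {Θ : Type*} (θ : Θ) (g : Gate n Θ) :
    g.op θ ∈ unitaryGroup (Bits n) ℂ := by
  cases g with
  | fixed W => exact W.2
  | trainable S g => exact onQubits_mem_unitaryGroup S (g θ).2

theorem QNN.op_mem_unitaryGroup {Θ : Type*} (V : QNN n Θ) (θ : Θ) :
    V.op θ ∈ unitaryGroup (Bits n) ℂ := by
  refine list_prod_mem fun X hX => ?_
  obtain ⟨g, -, rfl⟩ := List.mem_map.1 hX
  exact g.op_mem_unitaryGroup θ

/-- A finite labelling of the parameters of a local gate such that parameters with the same label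
give nearby gates. -/
theorem exists_gate_labelling {Θ : Type*} {κ : ℕ} {S : Finset (Fin n)} (hS : S.card ≤ κ)
    (g : Θ → unitaryGroup (S → Fin 2) ℂ) {q : ℕ} (hq : 0 < q) :
    ∃ (F : Type) (_ : Fintype F) (r : Θ → F),
      Fintype.card F ≤ (2 * q + 1) ^ (2 * 4 ^ κ) ∧
      ∀ α β, r α = r β →
        ‖onQubits S (g α : Matrix (S → Fin 2) (S → Fin 2) ℂ) - onQubits S (g β)‖ ≤
          2 * 4 ^ κ / q := by
  have hq' : (0 : ℝ) < q := by exact_mod_cast hq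
  refine ⟨(S → Fin 2) → (S → Fin 2) → Fin (2 * q + 1) × Fin (2 * q + 1), inferInstance,
    fun θ a b => (cell q ((g θ : Matrix _ _ ℂ) a b).re, cell q ((g θ : Matrix _ _ ℂ) a b).im),
    ?_, ?_⟩
  · simp only [Fintype.card_pi, Fintype.card_prod, Fintype.card_fin, Finset.prod_const,
      Finset.card_univ, Fintype.card_coe]
    rw [← sq, ← pow_mul, ← pow_mul]
    refine Nat.pow_le_pow_right (by omega) ?_
    rw [← mul_pow]
    exact Nat.mul_le_mul_left _ (Nat.pow_le_pow_right (by norm_num) hS)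
  · intro α β h
    rw [← onQubits_sub]
    refine (norm_onQubits_le S _).trans ?_
    have hentry : ∀ a b, ‖((g α : Matrix (S → Fin 2) (S → Fin 2) ℂ) - g β) a b‖ ≤ 2 / q := by
      intro a b
      have hab := congrFun (congrFun h a) b
      simp only [Prod.mk.injEq] at hab
      have hα := entry_norm_bound_of_unitary (g α).2 a b
      have hβ := entry_norm_bound_of_unitary (g β).2 a b
      have h1 := abs_sub_le_of_cell_eq hq ((Complex.abs_re_le_norm _).trans hα)
        ((Complex.abs_re_le_norm _).trans hβ) hab.1
      have h2 := abs_sub_le_of_cell_eq hq ((Complex.abs_im_le_norm _).trans hα)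
        ((Complex.abs_im_le_norm _).trans hβ) hab.2
      refine (Complex.norm_le_abs_re_add_abs_im _).trans ?_
      rw [Matrix.sub_apply, Complex.sub_re, Complex.sub_im]
      calc _ ≤ 1 / (q : ℝ) + 1 / q := add_le_add h1 h2
        _ = 2 / q := by ring
    calc _ ≤ ∑ _a : S → Fin 2, ∑ _b : S → Fin 2, 2 / (q : ℝ) :=
          Finset.sum_le_sum fun a _ => Finset.sum_le_sum fun b _ => hentry a b
      _ = 4 ^ S.card * 2 / q := by
          simp only [Finset.sum_const, Finset.card_univ, Fintype.card_pi, Fintype.card_fin,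
            Finset.prod_const, Fintype.card_coe, nsmul_eq_mul]
          rw [show (4 : ℝ) = 2 * 2 by norm_num, mul_pow]
          push_cast
          ring
      _ ≤ 4 ^ κ * 2 / q := by gcongr; norm_num
      _ = _ := by ring

theorem norm_mul_sub_mul_le {ι : Type} [Fintype ι] [DecidableEq ι] {A A' B B' : Matrix ι ι ℂ}
    (hA' : ‖A'‖ ≤ 1) (hB : ‖B‖ ≤ 1) : ‖A * B - A' * B'‖ ≤ ‖A - A'‖ + ‖B - B'‖ := by
  have : A * B - A' * B' = (A - A') * B + A' * (B - B') := by noncomm_ring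
  rw [this]
  refine (norm_add_le _ _).trans (add_le_add ?_ ?_)
  · exact (norm_mul_le _ _).trans (mul_le_of_le_one_right (norm_nonneg _) hB)
  · exact (norm_mul_le _ _).trans (mul_le_of_le_one_left (norm_nonneg _) hA')

theorem norm_le_one_of_unitary {ι : Type} [Fintype ι] [DecidableEq ι] {A : Matrix ι ι ℂ}
    (hA : A ∈ unitaryGroup ι ℂ) : ‖A‖ ≤ 1 := by
  have h := l2_opNorm_conjTranspose_mul_self A
  have h1 := norm_le_one_of_isStarProjection (IsStarProjection.one (R := Matrix ι ι ℂ))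
  rw [show Aᴴ * A = 1 from mem_unitaryGroup_iff'.1 hA] at h
  nlinarith [norm_nonneg A]

/-- A finite labelling of the parameters of a network such that parameters with the same label
give nearby operators. -/
theorem QNN.exists_labelling {Θ : Type*} {κ : ℕ} (V : QNN n Θ) (hV : V.IsLocal κ) {q : ℕ}
    (hq : 0 < q) :
    ∃ (F : Type) (_ : Fintype F) (r : Θ → F),
      Fintype.card F ≤ ((2 * q + 1) ^ (2 * 4 ^ κ)) ^ V.numTrainable ∧
      ∀ α β, r α = r β → ‖V.op α - V.op β‖ ≤ V.numTrainable * (2 * 4 ^ κ / q) := by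
  induction V with
  | nil => exact ⟨Unit, inferInstance, fun _ => (), by simp [QNN.numTrainable],
      by simp [QNN.op, QNN.numTrainable]⟩
  | cons g V ih =>
    obtain ⟨F, hF, r, hcard, hr⟩ := ih fun g hg => hV g (List.mem_cons_of_mem _ hg)
    have hop : ∀ θ, QNN.op (g :: V) θ = g.op θ * QNN.op V θ := fun θ => by simp [QNN.op]
    have hmul : ∀ α β, ‖QNN.op (g :: V) α - QNN.op (g :: V) β‖ ≤
        ‖g.op α - g.op β‖ + ‖QNN.op V α - QNN.op V β‖ := fun α β => by
      rw [hop, hop]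
      exact norm_mul_sub_mul_le (norm_le_one_of_unitary (g.op_mem_unitaryGroup β))
        (norm_le_one_of_unitary (QNN.op_mem_unitaryGroup V α))
    cases g with
    | fixed W =>
      have hnum : QNN.numTrainable (Gate.fixed W :: V) = QNN.numTrainable V := by
        simp [QNN.numTrainable, Gate.isTrainable]
      rw [hnum]
      refine ⟨F, hF, r, hcard, fun α β h => (hmul α β).trans ?_⟩
      simpa [Gate.op] using hr α β h
    | trainable S g =>
      have hnum : QNN.numTrainable (Gate.trainable S g :: V) = QNN.numTrainable V + 1 :=
        List.countP_cons_of_pos rfl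
      rw [hnum]
      have hS : S.card ≤ κ := hV (Gate.trainable S g) (List.mem_cons_self ..)
      obtain ⟨F', hF', r', hcard', hr'⟩ := exists_gate_labelling hS g hq
      refine ⟨F × F', inferInstance, fun θ => (r θ, r' θ), ?_, fun α β h => ?_⟩
      · rw [Fintype.card_prod, pow_succ]
        exact Nat.mul_le_mul hcard hcard'
      · simp only [Prod.mk.injEq] at h
        refine (hmul α β).trans ?_
        have h1 := hr α β h.1
        have h2 := hr' α β h.2
        push_cast
        rw [add_mul, one_mul]
        simp only [Gate.op]
        linarith

end QSim

namespace QSim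

section chaining

variable {Ω 𝒳 : Type*} [MeasurableSpace Ω] [MeasurableSpace 𝒳] {P : Measure Ω}
  {ν : Measure 𝒳} {N : ℕ} {Z : Fin N → Ω → 𝒳}

/-- The gap between the expectation of `f` and its empirical mean over the sample `z`. -/
noncomputable def sampleGap (ν : Measure 𝒳) {N : ℕ} (z : Fin N → 𝒳) (f : 𝒳 → ℝ) : ℝ :=
  ∫ x, f x ∂ν - (1 / (N : ℝ)) * ∑ j, f (z j)

theorem integrable_of_abs_le [IsProbabilityMeasure ν] {f : 𝒳 → ℝ} (hf : Measurable f) {b : ℝ}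
    (hb : ∀ x, |f x| ≤ b) : Integrable f ν :=
  Integrable.of_bound hf.aestronglyMeasurable b (.of_forall hb)

theorem sampleGap_sub (z : Fin N → 𝒳) {f g : 𝒳 → ℝ}
    (hf : Integrable f ν) (hg : Integrable g ν) :
    sampleGap ν z (fun x => f x - g x) = sampleGap ν z f - sampleGap ν z g := by
  rw [sampleGap, sampleGap, sampleGap, integral_sub hf hg, Finset.sum_sub_distrib]
  ring

theorem abs_sampleGap_le [IsProbabilityMeasure ν] (hN : 1 ≤ N) (z : Fin N → 𝒳) {f : 𝒳 → ℝ}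
    {b : ℝ} (hb : ∀ x, |f x| ≤ b) : |sampleGap ν z f| ≤ 2 * b := by
  have hN0 : (0 : ℝ) < N := by positivity
  have h1 : |∫ x, f x ∂ν| ≤ b := by
    simpa using norm_integral_le_of_norm_le_const (μ := ν) (f := f) (.of_forall hb)
  have h2 : |(1 / (N : ℝ)) * ∑ j, f (z j)| ≤ b := by
    rw [abs_mul, abs_of_pos (by positivity)]
    calc _ ≤ (1 / (N : ℝ)) * ∑ _j : Fin N, b := by
          gcongr
          exact (Finset.abs_sum_le_sum_abs _ _).trans (Finset.sum_le_sum fun j _ => hb _)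
      _ = b := by simp; field_simp
  rw [sampleGap]
  exact (abs_sub _ _).trans (by linarith)

/-- Hoeffding inequality for the empirical mean of a bounded function. -/
theorem measure_sampleGap_ge_le [IsProbabilityMeasure P] (hN : 1 ≤ N)
    (hlaw : ∀ j, HasLaw (Z j) ν P) (hind : iIndepFun Z P) {f : 𝒳 → ℝ} (hf : Measurable f) {b : ℝ}
    (hb : ∀ x, |f x| ≤ b) {s : ℝ} (hs : 0 ≤ s) :
    P.real {ω | s ≤ sampleGap ν (fun j => Z j ω) f} ≤ Real.exp (-(N * s ^ 2 / (2 * b ^ 2))) := by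
  have hN0 : (0 : ℝ) < N := by positivity
  have hmeas : ∀ j, AEMeasurable (fun ω => -f (Z j ω)) P := fun j =>
    (hf.comp_aemeasurable (hlaw j).aemeasurable).neg
  have hmean : ∀ j, ∫ ω, -f (Z j ω) ∂P = -∫ x, f x ∂ν := fun j => by
    rw [integral_neg, ← (hlaw j).map_eq, integral_map (hlaw j).aemeasurable
      hf.aestronglyMeasurable]
  have hsub : ∀ j, HasSubgaussianMGF (fun ω => -f (Z j ω) - -∫ x, f x ∂ν) ((‖b - -b‖₊ / 2) ^ 2) P :=
    fun j => by
      have := hasSubgaussianMGF_of_mem_Icc (a := -b) (b := b) (hmeas j)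
        (.of_forall fun ω => by
          have := abs_le.1 (hb (Z j ω))
          exact ⟨by linarith, by linarith⟩)
      rwa [hmean j] at this
  have hindep : iIndepFun (fun j ω => -f (Z j ω) - -∫ x, f x ∂ν) P :=
    hind.comp (fun _ x => -f x - -∫ x, f x ∂ν) fun _ => by fun_prop
  have h := HasSubgaussianMGF.measure_sum_ge_le_of_iIndepFun hindep (s := Finset.univ)
    (fun j _ => hsub j) (ε := N * s) (by positivity)
  have hset : {ω | s ≤ sampleGap ν (fun j => Z j ω) f} =
      {ω | N * s ≤ ∑ j, (-f (Z j ω) - -∫ x, f x ∂ν)} := by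
    ext ω
    have : ∑ j, (-f (Z j ω) - -∫ x, f x ∂ν) = N * sampleGap ν (fun j => Z j ω) f := by
      rw [sampleGap, Finset.sum_sub_distrib]
      simp
      field_simp
      ring
    simp only [Set.mem_ofPred_eq, this]
    exact (mul_le_mul_iff_right₀ hN0).symm
  rw [hset]
  refine h.trans (le_of_eq ?_)
  congr 1
  have hb2 : (((‖b - -b‖₊ / 2) ^ 2 : NNReal) : ℝ) = b ^ 2 := by
    push_cast
    rw [sub_neg_eq_add, Real.norm_eq_abs, div_pow, sq_abs]
    ring
  simp only [Finset.sum_const, Finset.card_univ, Fintype.card_fin, nsmul_eq_mul, NNReal.coe_mul,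
    NNReal.coe_natCast, hb2]
  rw [neg_div]
  congr 1
  by_cases hb0 : b = 0
  · simp [hb0]
  · field_simp

theorem measure_sampleGap_ge_le_ofReal [IsProbabilityMeasure P] (hN : 1 ≤ N)
    (hlaw : ∀ j, HasLaw (Z j) ν P) (hind : iIndepFun Z P) {f : 𝒳 → ℝ} (hf : Measurable f) {b : ℝ}
    (hb : ∀ x, |f x| ≤ b) (hb0 : 0 < b) {s y : ℝ} (hs : 0 ≤ s) (hy : y * (2 * b ^ 2) ≤ N * s ^ 2) :
    P {ω | s ≤ sampleGap ν (fun j => Z j ω) f} ≤ ENNReal.ofReal (Real.exp (-y)) := by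
  rw [← ofReal_measureReal]
  refine ENNReal.ofReal_le_ofReal ((measure_sampleGap_ge_le hN hlaw hind hf hb hs).trans ?_)
  rw [Real.exp_le_exp, neg_le_neg_iff, le_div_iff₀ (by positivity)]
  exact hy

theorem measure_iUnion_fintype_le_ofReal {F : Type*} [Fintype F] (A : F → Set Ω) {c y : ℝ}
    (hcard : (Fintype.card F : ℝ) ≤ Real.exp c)
    (hA : ∀ p, P (A p) ≤ ENNReal.ofReal (Real.exp (-(c + y)))) :
    P (⋃ p, A p) ≤ ENNReal.ofReal (Real.exp (-y)) := by
  calc P (⋃ p, A p) ≤ ∑ p, P (A p) := measure_iUnion_fintype_le _ _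
    _ ≤ ∑ _p : F, ENNReal.ofReal (Real.exp (-(c + y))) := Finset.sum_le_sum fun p _ => hA p
    _ = ENNReal.ofReal (Fintype.card F * Real.exp (-(c + y))) := by
        rw [Finset.sum_const, Finset.card_univ, nsmul_eq_mul, ENNReal.ofReal_mul (by positivity),
          ENNReal.ofReal_natCast]
    _ ≤ ENNReal.ofReal (Real.exp (-y)) := by
        refine ENNReal.ofReal_le_ofReal ?_
        calc _ ≤ Real.exp c * Real.exp (-(c + y)) := by gcongr
          _ = Real.exp (-y) := by rw [← Real.exp_add]; congr 1; ring

theorem sum_range_succ_div_two_pow (k : ℕ) :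
    ∑ m ∈ Finset.range k, ((m : ℝ) + 1) / 2 ^ m = 4 - (2 * k + 4) / 2 ^ k := by
  induction k with
  | zero => norm_num
  | succ k ih =>
    rw [Finset.sum_range_succ, ih, pow_succ]
    push_cast
    field_simp
    ring

/-- Uniform deviation bound by chaining, for a family of functions that has, at each scale
`2⁻ᵐ`, a labelling with at most `exp (a (m + 1) Y)` labels. -/
theorem measure_exists_sampleGap_gt_le [IsProbabilityMeasure P] [IsProbabilityMeasure ν]
    (hN : 1 ≤ N) (hlaw : ∀ j, HasLaw (Z j) ν P) (hind : iIndepFun Z P)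
    {Θ : Type*} [Nonempty Θ] {L : Θ → 𝒳 → ℝ} (hL : ∀ θ, Measurable (L θ))
    (hL1 : ∀ θ x, |L θ x| ≤ 1) {F : ℕ → Type} [∀ m, Fintype (F m)] (r : ∀ m, Θ → F m)
    (hr : ∀ m α β, r m α = r m β → ∀ x, |L α x - L β x| ≤ 2 / 2 ^ m)
    {a Y δ : ℝ} (ha : 0 ≤ a) (hcard : ∀ m, (Fintype.card (F m) : ℝ) ≤ Real.exp (a * (m + 1) * Y))
    (hδ : 0 < δ) (hY2 : Real.log 2 ≤ Y) (hYδ : Real.log (1 / δ) ≤ Y) :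
    P {ω | ∃ θ, 13 * Real.sqrt (6 * (a + 1) * (Y / N)) < sampleGap ν (fun j => Z j ω) (L θ)} ≤
      ENNReal.ofReal δ := by
  classical
  have hN0 : (0 : ℝ) < N := by positivity
  have hY : 0 < Y := (Real.log_pos (by norm_num)).trans_le hY2
  set u := Real.sqrt (6 * (a + 1) * (Y / N)) with hu
  have hu0 : 0 ≤ u := Real.sqrt_nonneg _
  have hu2 : N * u ^ 2 = 6 * (a + 1) * Y := by
    rw [hu, Real.sq_sqrt (by positivity)]; field_simp
  let rep : ∀ m, F m → Θ := fun m => Function.invFun (r m)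
  have hrep : ∀ m θ, r m (rep m (r m θ)) = r m θ := fun m θ => Function.invFun_eq ⟨θ, rfl⟩
  let D : Ω → (𝒳 → ℝ) → ℝ := fun ω f => sampleGap ν (fun j => Z j ω) f
  let inc : ∀ m, F m × F (m + 1) → 𝒳 → ℝ := fun m p x => L (rep (m + 1) p.2) x - L (rep m p.1) x
  let good : ∀ m, F m × F (m + 1) → Prop := fun m p => ∀ x, |inc m p x| ≤ 3 / 2 ^ m
  let s : ℕ → ℝ := fun m => 3 * ((m + 1) / 2 ^ m) * u
  let bad₀ : Set Ω := ⋃ p : F 0, {ω | u ≤ D ω (L (rep 0 p))}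
  let bad : ℕ → Set Ω := fun m => ⋃ p : F m × F (m + 1), {ω | good m p ∧ s m ≤ D ω (inc m p)}
  have hsmall : ∀ m : ℕ, Real.exp (-(Y + (m + 1) * Y)) ≤ δ / 2 * (1 / 2) ^ m := fun m => by
    have h1 : Real.exp (-Y) ≤ δ := by
      rw [← Real.le_log_iff_exp_le hδ]
      rw [one_div, Real.log_inv] at hYδ
      linarith
    have h2 : Real.exp (-((m + 1) * Y)) ≤ (1 / 2) ^ (m + 1) := by
      have : Real.exp (-Y) ≤ 1 / 2 := by
        rw [← Real.le_log_iff_exp_le (by norm_num), one_div, Real.log_inv]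
        linarith
      calc Real.exp (-((m + 1) * Y)) = Real.exp (-Y) ^ (m + 1) := by
            rw [← Real.exp_nat_mul]; congr 1; push_cast; ring
        _ ≤ _ := pow_le_pow_left₀ (Real.exp_pos _).le this _
    rw [neg_add, Real.exp_add]
    calc _ ≤ δ * (1 / 2) ^ (m + 1) := by gcongr
      _ = _ := by ring
  have hbad₀ : P bad₀ ≤ ENNReal.ofReal (δ / 2) := by
    have h := measure_iUnion_fintype_le_ofReal (P := P) (fun p : F 0 => {ω | u ≤ D ω (L (rep 0 p))})
      (c := a * ((0 : ℕ) + 1) * Y) (y := Y + ((0 : ℕ) + 1) * Y) (hcard 0) fun p => by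
        refine measure_sampleGap_ge_le_ofReal hN hlaw hind (hL _) (hL1 _) one_pos hu0 ?_
        rw [hu2]
        push_cast
        nlinarith
    refine h.trans (ENNReal.ofReal_le_ofReal ?_)
    simpa using hsmall 0
  have hbad : ∀ m, P (bad m) ≤ ENNReal.ofReal (δ / 2 * (1 / 2) ^ (m + 1)) := fun m => by
    have h := measure_iUnion_fintype_le_ofReal (P := P)
      (fun p : F m × F (m + 1) => {ω | good m p ∧ s m ≤ D ω (inc m p)})
      (c := a * (m + 1) * Y + a * ((m + 1 : ℕ) + 1) * Y) (y := Y + ((m + 1 : ℕ) + 1) * Y)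
      (by
        rw [Fintype.card_prod, Real.exp_add]
        push_cast
        have h2 := hcard (m + 1)
        push_cast at h2
        exact mul_le_mul (hcard m) h2 (by positivity) (Real.exp_pos _).le) fun p => by
        by_cases hg : good m p
        · simp only [hg, true_and]
          refine measure_sampleGap_ge_le_ofReal hN hlaw hind ((hL _).sub (hL _)) hg (by positivity)
            (by positivity) ?_
          have h1 : N * s m ^ 2 = 9 / (2 ^ m) ^ 2 * ((m + 1) ^ 2 * (6 * (a + 1) * Y)) := by
            rw [← hu2]; simp only [s]; field_simp; ring
          have h2 : ∀ w : ℝ, w * (2 * (3 / 2 ^ m) ^ 2) = 9 / (2 ^ m) ^ 2 * (2 * w) := fun w => by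
            field_simp; ring
          rw [h1, h2]
          refine mul_le_mul_of_nonneg_left ?_ (by positivity)
          have hm : (0 : ℝ) ≤ m := Nat.cast_nonneg m
          have haY : 0 ≤ a * Y := by positivity
          push_cast
          nlinarith [mul_nonneg hm haY, mul_nonneg hm hY.le, mul_nonneg (mul_nonneg hm hm) haY,
            mul_nonneg (mul_nonneg hm hm) hY.le]
        · simp [hg]
    exact h.trans (ENNReal.ofReal_le_ofReal (hsmall (m + 1)))
  have hsub : {ω | ∃ θ, 13 * u < D ω (L θ)} ⊆ bad₀ ∪ ⋃ m, bad m := by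
    rintro ω ⟨θ, hθ⟩
    by_contra hω
    simp only [Set.mem_union, Set.mem_iUnion, not_or, not_exists, bad₀, bad, Set.mem_ofPred_eq,
      not_and, not_le] at hω
    obtain ⟨h0, hinc⟩ := hω
    refine absurd hθ (not_lt.2 ?_)
    let π : ℕ → Θ := fun m => rep m (r m θ)
    have hπ : ∀ m x, |L (π m) x - L θ x| ≤ 2 / 2 ^ m := fun m x => hr m _ _ (hrep m θ) x
    have hinteg : ∀ θ, Integrable (L θ) ν := fun θ => integrable_of_abs_le (hL θ) (hL1 θ)
    have hstep : ∀ m, D ω (L (π (m + 1))) ≤ D ω (L (π m)) + s m := fun m => by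
      have hg : good m (r m θ, r (m + 1) θ) := fun x => by
        have h1 := hπ m x
        have h2 := hπ (m + 1) x
        have h3 : |inc m (r m θ, r (m + 1) θ) x| ≤ |L (π (m + 1)) x - L θ x| +
            |L (π m) x - L θ x| := by
          have := abs_sub (L (π (m + 1)) x - L θ x) (L (π m) x - L θ x)
          rwa [sub_sub_sub_cancel_right] at this
        have h4 : (2 : ℝ) / 2 ^ (m + 1) + 2 / 2 ^ m = 3 / 2 ^ m := by
          rw [pow_succ]; field_simp; norm_num
        linarith
      have h1 := hinc m _ hg
      have h2 : D ω (L (π (m + 1))) = D ω (L (π m)) + D ω (inc m (r m θ, r (m + 1) θ)) := by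
        have : D ω (inc m (r m θ, r (m + 1) θ)) = D ω (L (π (m + 1))) - D ω (L (π m)) :=
          sampleGap_sub _ (hinteg _) (hinteg _)
        linarith
      linarith
    have hchain : ∀ k, D ω (L (π k)) ≤ u + ∑ m ∈ Finset.range k, s m := fun k => by
      induction k with
      | zero => simpa using (h0 (r 0 θ)).le
      | succ k ih => rw [Finset.sum_range_succ]; linarith [hstep k]
    have hsum : ∀ k, ∑ m ∈ Finset.range k, s m ≤ 12 * u := fun k => by
      simp only [s]
      rw [← Finset.sum_mul, ← Finset.mul_sum, sum_range_succ_div_two_pow]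
      have : (0 : ℝ) ≤ (2 * k + 4) / 2 ^ k := by positivity
      exact mul_le_mul_of_nonneg_right (by linarith) hu0
    have hlim : ∀ k : ℕ, D ω (L θ) ≤ 13 * u + 4 * (1 / 2) ^ k := fun k => by
      have h1 : D ω (L θ) = D ω (L (π k)) + D ω (fun x => L θ x - L (π k) x) := by
        have : D ω (fun x => L θ x - L (π k) x) = D ω (L θ) - D ω (L (π k)) :=
          sampleGap_sub _ (hinteg _) (hinteg _)
        linarith
      have h2 := abs_sampleGap_le (ν := ν) hN (fun j => Z j ω) (f := fun x => L θ x - L (π k) x)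
        (fun x => by rw [abs_sub_comm]; exact hπ k x)
      have h3 := (abs_le.1 h2).2
      have h4 : (2 : ℝ) * (2 / 2 ^ k) = 4 * (1 / 2) ^ k := by
        rw [one_div, inv_pow]; ring
      have h5 := hchain k
      have h6 := hsum k
      change _ = _ + sampleGap ν _ _ at h1
      linarith
    have ht : Filter.Tendsto (fun k : ℕ => 13 * u + 4 * (1 / 2 : ℝ) ^ k) Filter.atTop
        (nhds (13 * u + 4 * 0)) :=
      ((tendsto_pow_atTop_nhds_zero_of_lt_one (by norm_num) (by norm_num)).const_mul 4).const_add _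
    rw [mul_zero, add_zero] at ht
    exact ge_of_tendsto' ht hlim
  calc _ ≤ P bad₀ + ∑' m, P (bad m) :=
        (measure_mono hsub).trans ((measure_union_le _ _).trans
          (add_le_add le_rfl (measure_iUnion_le _)))
    _ ≤ ENNReal.ofReal (δ / 2) + ∑' m, ENNReal.ofReal (δ / 2 * (1 / 2) ^ (m + 1)) :=
        add_le_add hbad₀ (ENNReal.tsum_le_tsum hbad)
    _ = ENNReal.ofReal δ := by
        have hs : HasSum (fun m : ℕ => δ / 2 * (1 / 2 : ℝ) ^ (m + 1)) (δ / 2) := by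
          have := (hasSum_geometric_two.mul_left (δ / 4))
          rw [show δ / 4 * 2 = δ / 2 by ring] at this
          have hfun : (fun m : ℕ => δ / 2 * (1 / 2 : ℝ) ^ (m + 1)) =
              fun m : ℕ => δ / 4 * (1 / 2 : ℝ) ^ m := by
            ext m; rw [pow_succ]; ring
          rw [hfun]
          exact this
        rw [← ENNReal.ofReal_tsum_of_nonneg (fun m => by positivity) hs.summable, hs.tsum_eq,
          ← ENNReal.ofReal_add (by positivity) (by positivity)]
        congr 1
        ring

end chaining

end QSim

namespace QSim

theorem map_uncurry_pi_pi {ι κ 𝒳 : Type*} [Fintype ι] [Fintype κ] [MeasurableSpace 𝒳]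
    (μ : Measure 𝒳) [IsProbabilityMeasure μ] :
    (Measure.pi fun _ : ι => Measure.pi fun _ : κ => μ).map (fun f (p : ι × κ) => f p.1 p.2) =
      Measure.pi fun _ : ι × κ => μ := by
  symm
  refine Measure.pi_eq fun s hs => ?_
  have hm : Measurable fun (f : ι → κ → 𝒳) (p : ι × κ) => f p.1 p.2 := by fun_prop
  rw [Measure.map_apply hm (MeasurableSet.univ_pi hs)]
  have : (fun (f : ι → κ → 𝒳) (p : ι × κ) => f p.1 p.2) ⁻¹' Set.univ.pi s =
      Set.univ.pi fun i => Set.univ.pi fun k => s (i, k) := by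
    ext f
    simp [Set.mem_pi]
  rw [this, Measure.pi_pi, Fintype.prod_prod_type]
  exact Finset.prod_congr rfl fun i _ => Measure.pi_pi _ _

section sample

variable {Ω 𝒳 : Type*} [MeasurableSpace Ω] [MeasurableSpace 𝒳] {P : Measure Ω}
  {μ : Measure 𝒳} {N n : ℕ} {ψ : Fin N → Fin n → Ω → 𝒳}

theorem hasLaw_pi_of_iIndepFun (hlaw : ∀ j i, HasLaw (ψ j i) μ P)
    (hind : iIndepFun (fun p : Fin N × Fin n => ψ p.1 p.2) P) (j : Fin N) :
    HasLaw (fun ω i => ψ j i ω) (Measure.pi fun _ => μ) P where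
  aemeasurable := aemeasurable_pi_lambda _ fun i => (hlaw j i).aemeasurable
  map_eq := by
    have h : iIndepFun (ψ j) P :=
      hind.precomp (g := fun i : Fin n => (j, i)) fun a b hab => (Prod.mk.inj hab).2
    rw [h.map_fun_eq_pi_map fun i => (hlaw j i).aemeasurable]
    simp only [(hlaw j _).map_eq]

theorem iIndepFun_rows [IsProbabilityMeasure P] [IsProbabilityMeasure μ]
    (hlaw : ∀ j i, HasLaw (ψ j i) μ P)
    (hind : iIndepFun (fun p : Fin N × Fin n => ψ p.1 p.2) P) :
    iIndepFun (fun j ω i => ψ j i ω) P := by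
  have hm : Measurable fun (f : Fin N × Fin n → 𝒳) (j : Fin N) (i : Fin n) => f (j, i) := by
    fun_prop
  have hm' : Measurable fun (f : Fin N → Fin n → 𝒳) (p : Fin N × Fin n) => f p.1 p.2 := by
    fun_prop
  have hae : AEMeasurable (fun ω (p : Fin N × Fin n) => ψ p.1 p.2 ω) P :=
    aemeasurable_pi_lambda _ fun p => (hlaw p.1 p.2).aemeasurable
  rw [iIndepFun_iff_map_fun_eq_pi_map fun j =>
    aemeasurable_pi_lambda _ fun i => (hlaw j i).aemeasurable]
  simp only [(hasLaw_pi_of_iIndepFun hlaw hind _).map_eq]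
  have h1 := hind.map_fun_eq_pi_map fun p : Fin N × Fin n => (hlaw p.1 p.2).aemeasurable
  simp only [(hlaw _ _).map_eq] at h1
  have h2 := congrArg (Measure.map fun (f : Fin N × Fin n → 𝒳) (j : Fin N) (i : Fin n) => f (j, i))
    h1
  rw [AEMeasurable.map_map_of_aemeasurable hm.aemeasurable hae, ← map_uncurry_pi_pi,
    Measure.map_map hm hm'] at h2
  exact h2.trans Measure.map_id

end sample

theorem exists_measurableSet_compl {Ω : Type*} [MeasurableSpace Ω] {P : Measure Ω}
    [IsProbabilityMeasure P] {B : Set Ω} {δ : ℝ} (hδ : 0 ≤ δ) (hB : P B ≤ ENNReal.ofReal δ) :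
    ∃ E : Set Ω, MeasurableSet E ∧ ENNReal.ofReal (1 - δ) ≤ P E ∧ ∀ ω ∈ E, ω ∉ B := by
  refine ⟨(toMeasurable P B)ᶜ, (measurableSet_toMeasurable _ _).compl, ?_,
    fun ω hω hB => hω (subset_toMeasurable _ _ hB)⟩
  rw [prob_compl_eq_one_sub (measurableSet_toMeasurable _ _), measure_toMeasurable,
    ENNReal.ofReal_sub _ hδ, ENNReal.ofReal_one]
  exact tsub_le_tsub_left hB _

/-- The constant in the entropy bound for networks of `κ`-local gates. -/
noncomputable def entropyConst (κ : ℕ) : ℝ := 2 * 4 ^ κ * (2 * κ + 4)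

theorem entropyConst_nonneg (κ : ℕ) : 0 ≤ entropyConst κ := by
  unfold entropyConst; positivity

open scoped Matrix.Norms.L2Operator in
theorem QNN.exists_labelling_scale {n : ℕ} {Θ : Type*} {κ : ℕ} (V : QNN n Θ) (hV : V.IsLocal κ)
    {K : ℕ} (hK : V.numTrainable = K) (hK1 : 1 ≤ K) {δ : ℝ} (hδ : 0 < δ) (hδ1 : δ < 1)
    (hKδ : K = 1 → δ ≤ 1 / 2) (m : ℕ) :
    ∃ (F : Type) (_ : Fintype F) (r : Θ → F),
      (Fintype.card F : ℝ) ≤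
        Real.exp (entropyConst κ * (m + 1) * (K * Real.log K + Real.log (1 / δ))) ∧
      ∀ α β, r α = r β → ‖V.op α - V.op β‖ ≤ 1 / 2 ^ m := by
  have hK0 : (0 : ℝ) < K := by exact_mod_cast hK1
  obtain ⟨F, hF, r, hcard, hr⟩ := V.exists_labelling hV (q := 2 * 4 ^ κ * K * 2 ^ m) (by positivity)
  refine ⟨F, hF, r, ?_, fun α β h => (hr α β h).trans (le_of_eq ?_)⟩
  · have hq : 2 * (2 * 4 ^ κ * K * 2 ^ m) + 1 ≤ 2 ^ (2 * κ + m + 3) * K := by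
      have h1 : 2 ^ (2 * κ + m + 3) * K = 8 * (4 ^ κ * K * 2 ^ m) := by
        rw [show (4 : ℕ) = 2 ^ 2 by norm_num, ← pow_mul]
        ring
      have h2 : 1 ≤ 4 ^ κ * K * 2 ^ m := Nat.one_le_iff_ne_zero.2 (by positivity)
      rw [h1]
      linarith [h2, show 2 * (2 * 4 ^ κ * K * 2 ^ m) = 4 * (4 ^ κ * K * 2 ^ m) by ring]
    have hlog2 : 0 < Real.log 2 := Real.log_pos (by norm_num)
    have hlogδ : 0 ≤ Real.log (1 / δ) := Real.log_nonneg (by rw [le_div_iff₀ hδ]; linarith)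
    have hkey : K * ((2 * κ + m + 3) * Real.log 2 + Real.log K) ≤
        (2 * κ + 4) * (m + 1) * (K * Real.log K + Real.log (1 / δ)) := by
      rcases hK1.eq_or_lt with h | h
      · rw [← h]
        have hd : Real.log 2 ≤ Real.log (1 / δ) := by
          refine Real.log_le_log (by norm_num) ?_
          rw [le_div_iff₀ hδ]
          linarith [hKδ h.symm]
        simp only [Nat.cast_one, Real.log_one, one_mul, add_zero, zero_add]
        refine mul_le_mul ?_ hd hlog2.le (by positivity)
        have h1 : (0 : ℝ) ≤ κ := Nat.cast_nonneg κ
        have h2 : (0 : ℝ) ≤ m := Nat.cast_nonneg m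
        nlinarith
      · have hl : Real.log 2 ≤ Real.log K :=
          Real.log_le_log (by norm_num) (by exact_mod_cast h)
        have h1 : (0 : ℝ) ≤ κ := Nat.cast_nonneg κ
        have h2 : (0 : ℝ) ≤ m := Nat.cast_nonneg m
        calc _ ≤ K * ((2 * κ + m + 3) * Real.log K + Real.log K) := by gcongr
          _ = (2 * κ + m + 4) * (K * Real.log K) := by ring
          _ ≤ (2 * κ + 4) * (m + 1) * (K * Real.log K) := by
              have : 0 ≤ Real.log K := hlog2.le.trans hl
              gcongr
              nlinarith
          _ ≤ _ := by gcongr; linarith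
    have hbase : (0 : ℝ) < 2 ^ (2 * κ + m + 3) * K := by positivity
    calc (Fintype.card F : ℝ) ≤ ((2 ^ (2 * κ + m + 3) * K) ^ (2 * 4 ^ κ)) ^ K := by
          rw [hK] at hcard
          exact_mod_cast hcard.trans (Nat.pow_le_pow_left (Nat.pow_le_pow_left hq _) _)
      _ = Real.exp (2 * 4 ^ κ * (K * ((2 * κ + m + 3) * Real.log 2 + Real.log K))) := by
          rw [← pow_mul, ← Real.exp_log (pow_pos hbase _), Real.log_pow,
            Real.log_mul (by positivity) hK0.ne', Real.log_pow]
          congr 1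
          push_cast
          ring
      _ ≤ _ := by
          rw [Real.exp_le_exp, entropyConst]
          calc _ ≤ 2 * 4 ^ κ * ((2 * κ + 4) * (m + 1) * (K * Real.log K + Real.log (1 / δ))) := by
                gcongr
            _ = _ := by ring
  · rw [hK]
    push_cast
    field_simp

open scoped Matrix.Norms.L2Operator in
/-- Uniform generalization bound for the local loss of a network. -/
theorem QNN.measure_generalization_le {n : ℕ} (hn : 1 ≤ n) {U : Op n}
    (hU : U ∈ unitaryGroup (Bits n) ℂ) {Θ : Type*} {κ : ℕ} (V : QNN n Θ) (hV : V.IsLocal κ) {K : ℕ}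
    (hK : V.numTrainable = K) {δ : ℝ} (hδ : 0 < δ) (hδ1 : δ < 1) (hKδ : K = 1 → δ ≤ 1 / 2) {N : ℕ}
    (hN : 1 ≤ N) {Ω : Type*} [MeasurableSpace Ω] {P : Measure Ω} [IsProbabilityMeasure P]
    {ψ : Fin N → Fin n → Ω → PureState (Fin 2)} (hlaw : ∀ j i, HasLaw (ψ j i) (haarState (Fin 2)) P)
    (hind : iIndepFun (fun p : Fin N × Fin n => ψ p.1 p.2) P) :
    P {ω | ∃ θ, 13 * Real.sqrt (6 * (entropyConst κ + 1) *
        ((K * Real.log K + Real.log (1 / δ)) / N)) <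
      expectedLoss U (V.op θ) - localTrainingCost U (V.op θ) fun j i => ψ j i ω} ≤
      ENNReal.ofReal δ := by
  have hlawZ := hasLaw_pi_of_iIndepFun hlaw hind
  have hindZ := iIndepFun_rows hlaw hind
  have hmeas : ∀ θ, Measurable (localLoss U (V.op θ)) := fun θ =>
    (continuous_localLoss U (V.op θ)).measurable
  have hone : ∀ θ x, |localLoss U (V.op θ) x| ≤ 1 := fun θ x => by
    rw [abs_of_nonneg (localLoss_nonneg hn hU (V.op_mem_unitaryGroup θ) x)]
    exact localLoss_le_one hn hU (V.op_mem_unitaryGroup θ) x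
  have hlogδ : 0 ≤ Real.log (1 / δ) := Real.log_nonneg (by rw [le_div_iff₀ hδ]; linarith)
  have hN0 : (0 : ℝ) < N := by positivity
  rcases isEmpty_or_nonempty Θ with hΘ | hΘ
  · simp
  obtain rfl | hK1 := Nat.eq_zero_or_pos K
  · obtain ⟨F, hF, r, hcard, hr⟩ := V.exists_labelling hV one_pos
    rw [hK, pow_zero] at hcard
    have hconst : ∀ α β, V.op α = V.op β := fun α β => by
      have := hr α β (Fintype.card_le_one_iff.1 hcard _ _)
      rw [hK, Nat.cast_zero, zero_mul] at this
      exact sub_eq_zero.1 (norm_le_zero_iff.1 this)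
    obtain ⟨θ₀⟩ := hΘ
    have h := measure_sampleGap_ge_le_ofReal hN hlawZ hindZ (hmeas θ₀) (hone θ₀) one_pos
      (y := Real.log (1 / δ)) (s := Real.sqrt (2 * (Real.log (1 / δ) / N))) (Real.sqrt_nonneg _)
      (by rw [Real.sq_sqrt (by positivity)]; apply le_of_eq; field_simp)
    rw [one_div, Real.log_inv, neg_neg, Real.exp_log hδ] at h
    refine (measure_mono ?_).trans h
    rintro ω ⟨θ, hθ⟩
    rw [hconst θ θ₀] at hθ
    refine le_trans ?_ hθ.le
    have hc := entropyConst_nonneg κ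
    have hle : Real.sqrt (2 * (-Real.log δ / N)) ≤ Real.sqrt (6 * (entropyConst κ + 1) *
        (((0 : ℕ) * Real.log (0 : ℕ) + Real.log (1 / δ)) / N)) := by
      rw [Nat.cast_zero, zero_mul, zero_add]
      rw [one_div, Real.log_inv] at hlogδ ⊢
      refine Real.sqrt_le_sqrt (mul_le_mul_of_nonneg_right ?_ (by positivity))
      linarith
    linarith [Real.sqrt_nonneg (6 * (entropyConst κ + 1) *
        (((0 : ℕ) * Real.log (0 : ℕ) + Real.log (1 / δ)) / N))]
  · choose F hF r hcard hr using fun m => V.exists_labelling_scale hV hK hK1 hδ hδ1 hKδ m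
    have hKlog : 0 ≤ K * Real.log K := by positivity
    have hY2 : Real.log 2 ≤ K * Real.log K + Real.log (1 / δ) := by
      rcases (Nat.succ_le_of_lt hK1).eq_or_lt with h | h
      · have : Real.log 2 ≤ Real.log (1 / δ) := by
          refine Real.log_le_log (by norm_num) ?_
          rw [le_div_iff₀ hδ]
          linarith [hKδ h.symm]
        linarith
      · have hK2 : (2 : ℝ) ≤ K := by exact_mod_cast h
        have hl : Real.log 2 ≤ Real.log K := Real.log_le_log (by norm_num) hK2
        nlinarith [Real.log_pos (by norm_num : (1 : ℝ) < 2)]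
    exact measure_exists_sampleGap_gt_le hN hlawZ hindZ hmeas hone r
      (fun m α β h x => by
        have h1 := abs_localLoss_sub_le hn hU (V.op_mem_unitaryGroup α)
          (V.op_mem_unitaryGroup β) x
        have h2 := hr m α β h
        calc _ ≤ 2 * (1 / 2 ^ m : ℝ) := h1.trans (by gcongr)
          _ = 2 / 2 ^ m := by ring)
      (entropyConst_nonneg κ) hcard hδ hY2 (by linarith)

end QSim

theorem mainTheorem2 (κ : ℕ) :
    ∃ C : ℝ, 0 < C ∧
      ∀ (n : ℕ) (_ : 1 ≤ n)
        (H : QSim.Op n) (_ : H.IsHermitian) (Δt : ℝ)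
        (U : QSim.Op n) (_ : U ∈ Matrix.unitaryGroup (QSim.Bits n) ℂ)
        (Θ : Type*) (V : QSim.QNN n Θ) (_ : V.IsLocal κ)
        (K : ℕ) (_ : V.numTrainable = K)
        (δ : ℝ) (_ : 0 < δ) (_ : δ < 1) (_ : K = 1 → δ ≤ 1 / 2)
        (N : ℕ) (_ : 1 ≤ N) (M : ℕ)
        (Ω : Type*) [MeasurableSpace Ω] (P : MeasureTheory.Measure Ω)
        [MeasureTheory.IsProbabilityMeasure P]
        (ψ : Fin N → Fin n → Ω → QSim.PureState (Fin 2))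
        (_ : ∀ j i, ProbabilityTheory.HasLaw (ψ j i) (QSim.haarState (Fin 2)) P)
        (_ : ProbabilityTheory.iIndepFun (fun p : Fin N × Fin n => ψ p.1 p.2) P)
        (αopt : Ω → Θ),
        ∃ E : Set Ω, MeasurableSet E ∧ ENNReal.ofReal (1 - δ) ≤ P E ∧
          ∀ ω ∈ E,
            QSim.simFidelity H Δt M (V.op (αopt ω)) ≥
              1 - 2 * (M : ℝ) ^ 2 *
                  (QSim.schattenTwoNorm (U - QSim.evolution H Δt) ^ 2 / ((2 : ℝ) ^ n + 1)
                    + 4 * (n : ℝ) *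
                      QSim.localTrainingCost U (V.op (αopt ω)) (fun j i => ψ j i ω))
                - C * ((M : ℝ) ^ 2 * (n : ℝ) *
                    (Real.sqrt ((K : ℝ) * Real.log (K : ℝ) / (N : ℝ))
                      + Real.sqrt (Real.log (1 / δ) / (N : ℝ)))) := by
  have hc := QSim.entropyConst_nonneg κ
  refine ⟨8 * (13 * Real.sqrt (6 * (QSim.entropyConst κ + 1))), by positivity, ?_⟩
  intro n hn H hH Δt U hU Θ V hV K hK δ hδ hδ1 hKδ N hN M Ω _ P _ ψ hlaw hind αopt
  obtain ⟨E, hE, hPE, hEB⟩ := QSim.exists_measurableSet_compl hδ.le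
    (V.measure_generalization_le hn hU hV hK hδ hδ1 hKδ hN hlaw hind)
  refine ⟨E, hE, hPE, fun ω hω => ?_⟩
  have h1 := hEB ω hω
  simp only [Set.mem_ofPred_eq, not_exists, not_lt] at h1
  have h2 := h1 (αopt ω)
  have h3 := QSim.simFidelity_ge hn hH Δt hU (V.op_mem_unitaryGroup (αopt ω)) M
  have h4 : Real.sqrt (((K : ℝ) * Real.log K + Real.log (1 / δ)) / N) ≤
      Real.sqrt ((K : ℝ) * Real.log K / N) + Real.sqrt (Real.log (1 / δ) / N) := by
    rw [add_div]
    refine Real.sqrt_le_iff.2 ⟨by positivity, ?_⟩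
    have hKN : 0 ≤ (K : ℝ) * Real.log K / N := by positivity
    have hδN : 0 ≤ Real.log (1 / δ) / N :=
      div_nonneg (Real.log_nonneg (by rw [le_div_iff₀ hδ]; linarith)) (Nat.cast_nonneg N)
    rw [add_sq, Real.sq_sqrt hKN, Real.sq_sqrt hδN]
    nlinarith [mul_nonneg (Real.sqrt_nonneg ((K : ℝ) * Real.log K / N))
      (Real.sqrt_nonneg (Real.log (1 / δ) / N))]
  rw [Real.sqrt_mul (by positivity)] at h2
  set c := Real.sqrt (6 * (QSim.entropyConst κ + 1))
  have hc0 : 0 ≤ c := Real.sqrt_nonneg _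
  have h5 : QSim.expectedLoss U (V.op (αopt ω)) ≤
      QSim.localTrainingCost U (V.op (αopt ω)) (fun j i => ψ j i ω) +
        13 * c * (Real.sqrt ((K : ℝ) * Real.log K / N) + Real.sqrt (Real.log (1 / δ) / N)) := by
    nlinarith [mul_le_mul_of_nonneg_left h4 hc0]
  have h6 : (0 : ℝ) ≤ 8 * ((M : ℝ) ^ 2 * n) := by positivity
  nlinarith [mul_le_mul_of_nonneg_left h5 h6]
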